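/- Let $n, j\ge 0$ be integers, and let $q,t\in\mathbf{C}$ with $q^m\ne 1$ for $1\le m\le j$. In $\mathbf{C}[S_n]$ let $\mathcal{J}_b=\sum_{a<b}(a\,b)$, $1\le b\le n$, be the (commuting) Jucys–Murphy elements, and for a partition $\mu$ of $n$ let $C_\mu=\sum_{h\in \mathrm{cyc}(\mu)}h$ be the sum of all permutations of cycle type $\mu$ and $\ell^*(\mu)=n-\ell(\mu)$ its colength. For a partition $\mu$ put $z_\mu=\prod_i i^{m_i(\mu)}m_i(\mu)!$, where $m_i(\mu)$ is the number of parts equal to $i$, and let $$g_j(\mathcal{J},q,t)=\sum_{|\mu|=j} z_\mu^{-1}\Big(\prod_{i=1}^{\ell(\mu)}\frac{1-t^{\mu_i}}{1-q^{\mu_i}}\Big)\,p_\mu(\mathcal{J}_1,\dots,\mathcal{J}_n)$$ be the $(q,t)$-analogue of the complete symmetric function, evaluated at the Jucys–Murphy elements ($p_\mu$ are the power sums). For partitions $\mu^{(1)},\dots,\mu^{(k)}$ of $n$, all different from $(1)^n$, let $\lambda$ be the partition with parts $\ell^*(\mu^{(1)}),\dots,\ell^*(\mu^{(k)})$, $|\mathrm{aut}(\lambda)|=\prod_i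 m_i(\lambda)!$, $\ell^*(\lambda)=|\lambda|-k$, and, with $D_\sigma=\prod_{u=1}^k\big(1-q^{\ell^*(\mu^{(\sigma(1))})}\cdots q^{\ell^*(\mu^{(\sigma(u))})}\big)$, $$W_{E(q)}(\mu^{(1)},\dots,\mu^{(k)})=\frac{1}{|\mathrm{aut}(\lambda)|}\sum_{\sigma\in S_k}\frac{q^{(k-1)\ell^*(\mu^{(\sigma(1))})}\cdots q^{\ell^*(\mu^{(\sigma(k-1))})}}{D_\sigma},\qquad W_{H(q)}(\mu^{(1)},\dots,\mu^{(k)})=\frac{(-1)^{\ell^*(\lambda)}}{|\mathrm{aut}(\lambda)|}\sum_{\sigma\in S_k}\frac{1}{D_\sigma}.$$ For $|q|<1$ these are equal to the absolutely convergent series $$\frac{1}{|\mathrm{aut}(\lambda)|}\sum_{\sigma\in S_k}\ \sum_{0\le i_1<\cdots<i_k}\ \prod_{u=1}^k q^{i_u\ell^*(\mu^{(\sigma(u))})}\quad\text{and}\quad \frac{(-1)^{\ell^*(\lambda)}}{|\mathrm{aut}(\lambda)|}\sum_{\sigma\in S_k}\ \sum_{0\le i_1\le\cdots\le i_k}\ \prod_{u=1}^k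 q^{i_u\ell^*(\mu^{(\sigma(u))})}$$ respectively, by which they are defined in that case. Then $g_j(\mathcal{J},q,t)$ lies in the center $\mathbf{Z}(\mathbf{C}[S_n])$, and $$g_j(\mathcal{J},q,t)=\sum_{e=0}^{j}(-t)^e\sum_{k=0}^{e}\ \sum_{\tilde k=0}^{j-e}\ \sum_{\mu^{(1)},\dots,\mu^{(k)};\ \nu^{(1)},\dots,\nu^{(\tilde k)}}W_{E(q)}(\mu^{(1)},\dots,\mu^{(k)})\,W_{H(q)}(\nu^{(1)},\dots,\nu^{(\tilde k)})\prod_{u=1}^{k}C_{\mu^{(u)}}\prod_{v=1}^{\tilde k}C_{\nu^{(v)}},$$ where the inner sum is over all families of partitions of $n$ different from $(1)^n$ with $\sum_u\ell^*(\mu^{(u)})=e$ and $\sum_v\ell^*(\nu^{(v)})=j-e$, listed so that $\ell^*(\mu^{(1)})\ge\cdots\ge\ell^*(\mu^{(k)})$ and $\ell^*(\nu^{(1)})\ge\cdots\ge\ell^*(\nu^{(\tilde k)})$ (families that differ by a reordering of different partitions of equal colength are counted separately). Moreover, for all $k,\tilde k\ge 0$ and all partitions $\mu^{(u)},\nu^{(v)}$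 of $n$, $$\prod_{u=1}^{k}C_{\mu^{(u)}}\prod_{v=1}^{\tilde k}C_{\nu^{(v)}}=\sum_{|\rho|=n}H(\mu^{(1)},\dots,\mu^{(k)},\nu^{(1)},\dots,\nu^{(\tilde k)},\rho)\,z_\rho\,C_\rho,$$ where $H(\mu^{(1)},\dots,\mu^{(m)})$ is $1/n!$ times the number of $(h_1,\dots,h_m)$ with $h_i\in\mathrm{cyc}(\mu^{(i)})$ and $h_1\cdots h_m=1$. -/

import Mathlib

namespace QuantumHurwitz

open Equiv

/-- The complex group algebra `ℂ[S_n]`. -/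
abbrev GroupAlg (n : ℕ) : Type := MonoidAlgebra ℂ (Perm (Fin n))

/-! ### Jucys–Murphy elements and substitution into polynomials -/

/-- The Jucys–Murphy element `𝒥_b = ∑_{a < b} (a b)`. -/
noncomputable def jucysMurphy (n : ℕ) (b : Fin n) : GroupAlg n :=
  ∑ a ∈ Finset.Iio b, MonoidAlgebra.single (swap a b) 1

theorem single_swap_commute {n : ℕ} {c a b : Fin n} (hca : c < a) (hab : a < b) :
    (MonoidAlgebra.single (swap c a) 1 : GroupAlg n) * jucysMurphy n b =
      jucysMurphy n b * MonoidAlgebra.single (swap c a) 1 := by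
  have hb : swap c a b = b := swap_apply_of_ne_of_ne (hca.trans hab).ne' hab.ne'
  unfold jucysMurphy
  rw [Finset.mul_sum, Finset.sum_mul]
  refine Finset.sum_bij' (fun x _ => swap c a x) (fun x _ => swap c a x) ?_ ?_ ?_ ?_ ?_
  · intro x hx
    rw [Finset.mem_Iio] at hx ⊢
    rw [swap_apply_def]
    split_ifs
    · exact hab
    · exact hca.trans hab
    · exact hx
  · intro x hx
    rw [Finset.mem_Iio] at hx ⊢
    rw [swap_apply_def]
    split_ifs
    · exact hab
    · exact hca.trans hab
    · exact hx
  · intro x _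
    exact swap_apply_self c a x
  · intro x _
    exact swap_apply_self c a x
  · intro x _
    rw [MonoidAlgebra.single_mul_single, MonoidAlgebra.single_mul_single,
      Equiv.mul_swap_eq_swap_mul, hb]

theorem jucysMurphy_comm_of_lt {n : ℕ} {a b : Fin n} (hab : a < b) :
    jucysMurphy n a * jucysMurphy n b = jucysMurphy n b * jucysMurphy n a := by
  have h : jucysMurphy n a = ∑ c ∈ Finset.Iio a, MonoidAlgebra.single (swap c a) 1 := rfl
  rw [h, Finset.sum_mul, Finset.mul_sum]
  exact Finset.sum_congr rfl fun c hc => single_swap_commute (Finset.mem_Iio.1 hc) hab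

theorem jucysMurphy_comm (n : ℕ) :
    ∀ x ∈ Set.range (jucysMurphy n), ∀ y ∈ Set.range (jucysMurphy n), x * y = y * x := by
  rintro _ ⟨a, rfl⟩ _ ⟨b, rfl⟩
  rcases lt_trichotomy a b with h | h | h
  · exact jucysMurphy_comm_of_lt h
  · rw [h]
  · exact (jucysMurphy_comm_of_lt h).symm

open scoped IsMulCommutative in
/-- Substitution of the Jucys–Murphy elements `(𝒥_1, …, 𝒥_n)` for the variables of a polynomial,
an algebra homomorphism into `ℂ[S_n]`.  The target of `MvPolynomial.aeval` has to be commutative,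
hence the detour through the commutative subalgebra generated by the `𝒥_b`. -/
noncomputable def substJM (n : ℕ) : MvPolynomial (Fin n) ℂ →ₐ[ℂ] GroupAlg n :=
  haveI : IsMulCommutative (Algebra.adjoin ℂ (Set.range (jucysMurphy n))) :=
    Algebra.isMulCommutative_adjoin ℂ (jucysMurphy_comm n)
  (Algebra.adjoin ℂ (Set.range (jucysMurphy n))).val.comp
    (MvPolynomial.aeval fun b =>
      (⟨jucysMurphy n b, Algebra.subset_adjoin (Set.mem_range_self b)⟩ :
        Algebra.adjoin ℂ (Set.range (jucysMurphy n))))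

theorem substJM_X (n : ℕ) (b : Fin n) : substJM n (MvPolynomial.X b) = jucysMurphy n b := by
  simp [substJM]

/-! ### The `(q,t)`-analogue `g_j` of the complete symmetric function -/

/-- `z_μ = ∏_i i^{m_i(μ)} m_i(μ)!`. -/
def zPart {n : ℕ} (μ : n.Partition) : ℕ :=
  ∏ i ∈ μ.parts.toFinset, i ^ μ.parts.count i * (μ.parts.count i).factorial

/-- `z_μ(q,t) = z_μ ∏_i (1 - q^{μ_i}) / (1 - t^{μ_i})`.  Only the inverse
`z_μ⁻¹ ∏_i (1 - t^{μ_i}) / (1 - q^{μ_i})` is used; with `x / 0 = 0` and `0⁻¹ = 0` it has the right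
value also where `t^{μ_i} = 1`. -/
noncomputable def zqt {n : ℕ} (q t : ℂ) (μ : n.Partition) : ℂ :=
  zPart μ * (μ.parts.map fun i => (1 - q ^ i) / (1 - t ^ i)).prod

/-- `g_j(x_1, …, x_n; q, t) = ∑_{|μ| = j} z_μ(q,t)⁻¹ p_μ(x_1, …, x_n)`. -/
noncomputable def gPoly (n j : ℕ) (q t : ℂ) : MvPolynomial (Fin n) ℂ :=
  ∑ μ : j.Partition, MvPolynomial.C (zqt q t μ)⁻¹ * MvPolynomial.psumPart (Fin n) ℂ μ

/-- `g_j(𝒥, q, t)`. -/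
noncomputable def gJM (n j : ℕ) (q t : ℂ) : GroupAlg n := substJM n (gPoly n j q t)

/-! ### Cycle-type sums, colength, Hurwitz numbers -/

/-- `cyc(μ)`: the permutations whose cycle lengths (fixed points included) are the parts of `μ`. -/
def cyc {n : ℕ} (μ : n.Partition) : Finset (Perm (Fin n)) :=
  Finset.univ.filter fun h => h.partition.parts = μ.parts

/-- The cycle-type sum `C_μ`. -/
noncomputable def cycleSum {n : ℕ} (μ : n.Partition) : GroupAlg n :=
  ∑ h ∈ cyc μ, MonoidAlgebra.single h 1

/-- The colength `ℓ*(μ) = |μ| - ℓ(μ)` of a partition of `n`. -/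
def colength {n : ℕ} (μ : n.Partition) : ℕ := n - μ.parts.card

/-- `μ` is not the cycle type `(1)^n` of the identity. -/
def IsNonIdentity {n : ℕ} (μ : n.Partition) : Prop := μ.parts ≠ Multiset.replicate n 1

/-- The Hurwitz number `H(μ⁽¹⁾, …, μ⁽ᵏ⁾)`: `1 / n!` times the number of ways to write the identity
as `h_1 ⋯ h_k` with `h_i ∈ cyc(μ⁽ⁱ⁾)`. -/
noncomputable def hurwitz {n : ℕ} (L : List n.Partition) : ℂ :=
  (Nat.card {w : List (Perm (Fin n)) //
    List.Forall₂ (fun h μ => h ∈ cyc μ) w L ∧ w.prod = 1} : ℂ) / n.factorial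

/-! ### The weights -/

/-- `|aut(λ)| = ∏_i m_i(λ)!` for the partition `λ` with parts `ℓ*(μ⁽¹⁾), …, ℓ*(μ⁽ᵏ⁾)`. -/
def autOrder {n k : ℕ} (μ : Fin k → n.Partition) : ℕ :=
  let lam : Multiset ℕ := Finset.univ.val.map fun u => colength (μ u)
  ∏ i ∈ lam.toFinset, (lam.count i).factorial

/-- The term `q^{i_1 ℓ*(μ^{(σ(1))})} ⋯ q^{i_k ℓ*(μ^{(σ(k))})}`. -/
def weightTerm {n k : ℕ} (q : ℂ) (μ : Fin k → n.Partition) (σ : Perm (Fin k))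
    (i : Fin k → ℕ) : ℂ :=
  ∏ u, q ^ (i u * colength (μ (σ u)))

/-- `W_{E(q)}`, as the sum over `0 ≤ i_1 < ⋯ < i_k`. -/
noncomputable def WE {n k : ℕ} (q : ℂ) (μ : Fin k → n.Partition) : ℂ :=
  (autOrder μ : ℂ)⁻¹ *
    ∑ σ : Perm (Fin k), ∑' i : {i : Fin k → ℕ // StrictMono i}, weightTerm q μ σ i.1

/-- The sign `(-1)^{ℓ*(λ)}`, `ℓ*(λ) = |λ| - ℓ(λ)`, for the partition `λ` with parts
`ℓ*(ν⁽¹⁾), …, ℓ*(ν⁽ᵏ⁾)`. -/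
def signH {n k : ℕ} (ν : Fin k → n.Partition) : ℂ :=
  (-1) ^ ((∑ v, colength (ν v)) - k)

/-- `W_{H(q)}`, as the sum over `0 ≤ i_1 ≤ ⋯ ≤ i_k`. -/
noncomputable def WH {n k : ℕ} (q : ℂ) (ν : Fin k → n.Partition) : ℂ :=
  signH ν * (autOrder ν : ℂ)⁻¹ *
    ∑ σ : Perm (Fin k), ∑' i : {i : Fin k → ℕ // Monotone i}, weightTerm q ν σ i.1

/-- `(1 - q^{ℓ*(μ^{(σ(1))})}) ⋯ (1 - q^{ℓ*(μ^{(σ(1))})} ⋯ q^{ℓ*(μ^{(σ(k))})})`. -/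
def weightDenom {n k : ℕ} (q : ℂ) (μ : Fin k → n.Partition) (σ : Perm (Fin k)) : ℂ :=
  ∏ u : Fin k, (1 - ∏ v ∈ Finset.Iic u, q ^ colength (μ (σ v)))

/-- The rational form of `W_{E(q)}`; the exponent of `q^{ℓ*(μ^{(σ(u))})}` in the numerator is
`k - u` for `u = 1, …, k`. -/
noncomputable def WErat {n k : ℕ} (q : ℂ) (μ : Fin k → n.Partition) : ℂ :=
  (autOrder μ : ℂ)⁻¹ *
    ∑ σ : Perm (Fin k),
      (∏ u : Fin k, q ^ ((u.rev : ℕ) * colength (μ (σ u)))) / weightDenom q μ σ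

/-- The rational form of `W_{H(q)}`. -/
noncomputable def WHrat {n k : ℕ} (q : ℂ) (ν : Fin k → n.Partition) : ℂ :=
  signH ν * (autOrder ν : ℂ)⁻¹ * ∑ σ : Perm (Fin k), 1 / weightDenom q ν σ

/-- `W_q = W_{E(q)} W_{H(q)}`, with the weights as series. -/
noncomputable def Wq {n : ℕ} (q : ℂ) (k k' : ℕ) (μ : Fin k → n.Partition)
    (ν : Fin k' → n.Partition) : ℂ :=
  WE q μ * WH q ν

/-- `W_q = W_{E(q)} W_{H(q)}`, with the weights in rational form. -/
noncomputable def Wqrat {n : ℕ} (q : ℂ) (k k' : ℕ) (μ : Fin k → n.Partition)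
    (ν : Fin k' → n.Partition) : ℂ :=
  WErat q μ * WHrat q ν

/-! ### The expansion -/

open scoped Classical in
/-- The families `(μ⁽¹⁾, …, μ⁽ᵏ⁾)` of non-identity partitions of `n` of total colength `d` whose
colengths `ℓ*(μ⁽¹⁾) ≥ ⋯ ≥ ℓ*(μ⁽ᵏ⁾)` are, in this order, the parts of a partition `λ` of `d`. -/
noncomputable def families (n k d : ℕ) : Finset (Fin k → n.Partition) :=
  Finset.univ.filter fun μ =>
    (∀ u, IsNonIdentity (μ u)) ∧ (Antitone fun u => colength (μ u)) ∧
      ∑ u, colength (μ u) = d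

/-- `∏_u C_{μ⁽ᵘ⁾} ∏_v C_{ν⁽ᵛ⁾}`. -/
noncomputable def cycleSumProd {n k k' : ℕ} (μ : Fin k → n.Partition) (ν : Fin k' → n.Partition) :
    GroupAlg n :=
  (List.ofFn fun u => cycleSum (μ u)).prod * (List.ofFn fun v => cycleSum (ν v)).prod

/-- The coefficient of `(-t)^e`: the weighted sum, for the weight `W`, of products of cycle-type
sums over families with total colengths `e` and `j - e`. -/
noncomputable def cycleCoeff (n j e : ℕ)
    (W : (k k' : ℕ) → (Fin k → n.Partition) → (Fin k' → n.Partition) → ℂ) : GroupAlg n :=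
  ∑ k ∈ Finset.range (e + 1), ∑ k' ∈ Finset.range (j - e + 1),
    ∑ μ ∈ families n k e, ∑ ν ∈ families n k' (j - e), W k k' μ ν • cycleSumProd μ ν

end QuantumHurwitz

/-!
The generating series `G(z) = ∑ g_m z^m` of the `(q,t)`-analogues factors formally as
`∏_{i ≥ 0} E(-t q^i z) / E(-q^i z)`, where `E(z) = ∏_b (1 + z x_b)`. Infinite products are avoided:
what is used of this factorization is the `q`-difference equation `G(z) E(-z) = G(qz) E(-tz)`,
which determines the coefficients of degree `≤ j` as long as `q^m ≠ 1` for `1 ≤ m ≤ j`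
(`eqUpTo_of_qDifference`).

* The series `G` satisfies the equation because both sides have the same logarithmic derivative
  (`partitionSum_qDifference`); this combines Newton's identities for `E` with the recurrence
  `m g_m = ∑_a (1 - t^a) / (1 - q^a) p_a g_{m-a}` (`mul_partitionSum`), obtained by removing a part
  from a partition.
* Let `F` and `B` be the series whose coefficients are sums of `e_{a_1} ⋯ e_{a_k}` over compositions,
  weighted by the terms of the rational forms of `W_{E(q)}` and `W_{H(q)}`. Splitting off the last
  part of a composition gives `F(z) = E(z) F(qz)` and `B(z) E(-z) = B(qz)`, so `F(-tz) B(z)` solves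
  the same equation as `G` (`gPoly_eq_sum_compTotal`).

By Jucys' theorem `e_a(𝒥) = ∑_{ℓ*(μ) = a} C_μ` (`substJM_esymm`), substituting Jucys–Murphy elements
turns the sums over compositions into sums over all families of non-identity partitions. As
products of the central elements `C_μ` do not depend on the order of the factors, these sums can be
symmetrized and restricted to weakly decreasing colengths, each family being divided by the order
`|aut(λ)|` of its stabilizer (`sum_antitone_symmetrize`).

For `‖q‖ < 1` the rational weights are sums of products of geometric series, in the gaps between
consecutive indices (`hasSum_hasGaps`). Finally, the Hurwitz number `H(…, ρ)` is `1 / n!` times the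
coefficient of the identity in a product of cycle-type sums; since this product is central, the
orbit count `|cyc(ρ)| z_ρ = n!` turns it into the coefficient of `C_ρ`
(`prod_cycleSum_eq_sum_hurwitz`).
-/

namespace QuantumHurwitz

open Equiv

/-! ### The Jucys expansion of elementary symmetric functions of Jucys–Murphy elements -/

/-- The colength `∑ (ℓ - 1)` of a permutation, the sum running over its cycle lengths `ℓ`. -/
def permColength {α : Type*} [Fintype α] [DecidableEq α] (σ : Perm α) : ℕ :=
  σ.cycleType.sum - σ.cycleType.card

theorem card_cycleType_le_sum {α : Type*} [Fintype α] [DecidableEq α] (σ : Perm α) :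
    σ.cycleType.card ≤ σ.cycleType.sum := by
  have h := Multiset.card_nsmul_le_sum (s := σ.cycleType) (a := 1)
    fun x hx => Perm.one_lt_of_mem_cycleType hx |>.le
  simpa using h

theorem permColength_mul_of_disjoint {α : Type*} [Fintype α] [DecidableEq α] {σ τ : Perm α}
    (h : Perm.Disjoint σ τ) : permColength (σ * τ) = permColength σ + permColength τ := by
  have h1 := card_cycleType_le_sum σ
  have h2 := card_cycleType_le_sum τ
  simp only [permColength, h.cycleType_mul, Multiset.sum_add, Multiset.card_add]
  omega

theorem permColength_formPerm {α : Type*} [Fintype α] [DecidableEq α] {l : List α}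
    (hl : l.Nodup) (h2 : 2 ≤ l.length) : permColength l.formPerm = l.length - 1 := by
  have hne : ∀ x, l ≠ [x] := by
    rintro x rfl
    simp at h2
  rw [permColength, (List.isCycle_formPerm hl h2).cycleType,
    List.support_formPerm_of_nodup l hl hne, List.toFinset_card_of_nodup hl]
  simp

/-- Multiplication by `(a k)`, where `k` is a fixed point of `σ`, inserts `k` into the cycle of
`σ` through `a`. -/
theorem permColength_swap_mul {α : Type*} [Fintype α] [DecidableEq α] {σ : Perm α} {a k : α}
    (hk : σ k = k) (hak : a ≠ k) : permColength (swap a k * σ) = permColength σ + 1 := by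
  by_cases ha : σ a = a
  · have hd : Perm.Disjoint (swap a k) σ := by
      intro x
      rcases eq_or_ne x a with rfl | hxa
      · exact Or.inr ha
      rcases eq_or_ne x k with rfl | hxk
      · exact Or.inr hk
      exact Or.inl (swap_apply_of_ne_of_ne hxa hxk)
    have hs : permColength (swap a k) = 1 := by
      rw [← List.formPerm_pair, permColength_formPerm (by simp [hak]) (by simp)]
      simp
    rw [permColength_mul_of_disjoint hd, hs, add_comm]
  · have ha' : a ∈ σ.support := Perm.mem_support.2 ha
    have hmem : σ.cycleOf a ∈ σ.cycleFactorsFinset :=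
      Perm.cycleOf_mem_cycleFactorsFinset_iff.2 ha'
    have hdis := (Perm.disjoint_mul_inv_of_mem_cycleFactorsFinset hmem).symm
    have hcomm := hdis.commute.eq
    have hσ : σ = σ.cycleOf a * (σ * (σ.cycleOf a)⁻¹) := by
      rw [hcomm]; simp
    have hlen : 2 ≤ (σ.toList a).length := Perm.two_le_length_toList_iff_mem_support.2 ha'
    have hnd := Perm.nodup_toList σ a
    have hknot : k ∉ σ.toList a := by
      rw [Perm.mem_toList_iff]
      rintro ⟨h, -⟩
      exact (h.apply_eq_self_iff.not.1 ha) hk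
    obtain ⟨l, hl⟩ : ∃ l, σ.toList a = a :: l := by
      cases h : σ.toList a with
      | nil => simp [h] at hlen
      | cons b l =>
        have h0 := Perm.toList_getElem_zero (p := σ) (x := a) ha'
        simp only [h, List.getElem_cons_zero] at h0
        exact ⟨l, by rw [h0]⟩
    have hform : (k :: σ.toList a).formPerm = swap a k * σ.cycleOf a := by
      rw [hl, List.formPerm_cons_cons, ← hl, Perm.formPerm_toList, swap_comm]
    have hd2 : Perm.Disjoint (swap a k * σ.cycleOf a) (σ * (σ.cycleOf a)⁻¹) := by
      rw [← hform]
      intro x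
      rcases hdis x with hx | hx
      · by_cases hxk : x = k
        · right
          have : (σ.cycleOf a)⁻¹ k = k := by
            rw [Perm.inv_eq_iff_eq, ← Perm.formPerm_toList, List.formPerm_apply_of_notMem hknot]
          rw [hxk, Perm.mul_apply, this, hk]
        · left
          refine List.formPerm_apply_of_notMem ?_
          rw [← Perm.formPerm_toList] at hx
          intro hmem'
          have hx' := (List.mem_cons.1 hmem').resolve_left hxk
          have := (List.formPerm_apply_mem_eq_self_iff _ hnd x hx').1 hx
          omega
      · exact Or.inr hx
    have e1 : permColength σ = (σ.toList a).length - 1 + permColength (σ * (σ.cycleOf a)⁻¹) := by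
      conv_lhs => rw [hσ]
      rw [permColength_mul_of_disjoint hdis]
      conv_lhs => rw [← Perm.formPerm_toList σ a, permColength_formPerm hnd hlen]
      rw [Perm.formPerm_toList]
    have e2 : swap a k * σ = (swap a k * σ.cycleOf a) * (σ * (σ.cycleOf a)⁻¹) := by
      conv_lhs => rw [hσ]
      rw [mul_assoc]
    rw [e2, permColength_mul_of_disjoint hd2, ← hform,
      permColength_formPerm (by simp [hknot, hnd]) (by simp; omega), e1, List.length_cons]
    omega

theorem permColength_eq_zero_iff {α : Type*} [Fintype α] [DecidableEq α] {σ : Perm α} :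
    permColength σ = 0 ↔ σ = 1 := by
  constructor
  · intro h
    have h1 := Multiset.card_nsmul_le_sum (s := σ.cycleType) (a := 2)
      fun x hx => Perm.two_le_of_mem_cycleType hx
    rw [permColength] at h
    rw [← Perm.card_cycleType_eq_zero]
    simp only [smul_eq_mul] at h1
    omega
  · rintro rfl
    simp [permColength]

theorem sum_powersetCard_insert_prod {ι R : Type*} [DecidableEq ι] [CommSemiring R]
    (x : ι → R) {s : Finset ι} {k : ι} (hk : k ∉ s) (a : ℕ) :
    ∑ t ∈ (insert k s).powersetCard (a + 1), ∏ i ∈ t, x i =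
      ∑ t ∈ s.powersetCard (a + 1), ∏ i ∈ t, x i + x k * ∑ t ∈ s.powersetCard a, ∏ i ∈ t, x i := by
  have hmem : ∀ t ∈ s.powersetCard a, k ∉ t := fun t ht h =>
    hk ((Finset.mem_powersetCard.1 ht).1 h)
  rw [Finset.powersetCard_succ_insert hk, Finset.sum_union, Finset.sum_image, Finset.mul_sum]
  · congr 1
    exact Finset.sum_congr rfl fun t ht => Finset.prod_insert (hmem t ht)
  · intro t ht t' ht' h
    have h1 := Finset.erase_insert (hmem t ht)
    rw [h, Finset.erase_insert (hmem t' ht')] at h1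
    exact h1.symm
  · rw [Finset.disjoint_left]
    intro t ht ht'
    obtain ⟨u, -, rfl⟩ := Finset.mem_image.1 ht'
    exact hk ((Finset.mem_powersetCard.1 ht).1 (Finset.mem_insert_self k u))

/-- The permutations that fix all points `≥ k`, of a given colength. -/
def permsBelow (n k a : ℕ) : Finset (Perm (Fin n)) :=
  Finset.univ.filter fun σ => (∀ i : Fin n, k ≤ i.val → σ i = i) ∧ permColength σ = a

theorem mem_permsBelow {n k a : ℕ} {σ : Perm (Fin n)} :
    σ ∈ permsBelow n k a ↔ (∀ i : Fin n, k ≤ i.val → σ i = i) ∧ permColength σ = a := by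
  simp [permsBelow]

theorem permsBelow_zero_right (n k : ℕ) : permsBelow n k 0 = {1} := by
  ext σ
  rw [mem_permsBelow, permColength_eq_zero_iff, Finset.mem_singleton]
  exact ⟨fun h => h.2, fun h => ⟨by simp [h], h⟩⟩

/-- A permutation that fixes all points `> k` and moves `k` is uniquely `(a k) σ` with `a < k` and
`σ` fixing all points `≥ k`. -/
theorem jucysMurphy_mul_sum_permsBelow {n k : ℕ} (hk : k < n) (a : ℕ) :
    jucysMurphy n ⟨k, hk⟩ * ∑ σ ∈ permsBelow n k a, MonoidAlgebra.single σ (1 : ℂ) =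
      ∑ σ ∈ (permsBelow n (k + 1) (a + 1)).filter (fun σ => σ ⟨k, hk⟩ ≠ ⟨k, hk⟩),
        MonoidAlgebra.single σ 1 := by
  set K : Fin n := ⟨k, hk⟩ with hK
  rw [jucysMurphy, Finset.sum_mul_sum, ← Finset.sum_product']
  refine Finset.sum_bij' (fun p _ => swap p.1 K * p.2) (fun τ _ => (τ K, swap (τ K) K * τ))
    ?_ ?_ ?_ ?_ ?_
  · rintro ⟨b, σ⟩ h
    rw [Finset.mem_product, Finset.mem_Iio, mem_permsBelow] at h
    obtain ⟨hb, hfix, hlen⟩ := h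
    have hσK : σ K = K := hfix K le_rfl
    rw [Finset.mem_filter, mem_permsBelow]
    refine ⟨⟨fun i hi => ?_, ?_⟩, ?_⟩
    · have h1 : i ≠ K := fun h => by rw [h] at hi; simp [hK] at hi
      have h2 : i ≠ b := fun h => by
        have := Fin.lt_def.1 hb
        rw [h] at hi
        simp only [hK] at this
        omega
      rw [Perm.mul_apply, hfix i (by omega), swap_apply_of_ne_of_ne h2 h1]
    · rw [permColength_swap_mul hσK (by exact hb.ne), hlen]
    · rw [Perm.mul_apply, hσK, swap_apply_right]
      exact hb.ne
  · intro τ h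
    rw [Finset.mem_filter, mem_permsBelow] at h
    obtain ⟨⟨hfix, hlen⟩, hmove⟩ := h
    have hlt : τ K < K := by
      rw [Fin.lt_def]
      by_contra hge
      have h1 : k + 1 ≤ (τ K).val := by
        have : (τ K).val ≠ k := fun h => hmove (Fin.ext h)
        simp only [hK] at hge this ⊢
        omega
      exact hmove (τ.injective (hfix _ h1))
    have hfixK : (swap (τ K) K * τ) K = K := by simp
    rw [Finset.mem_product, Finset.mem_Iio, mem_permsBelow]
    refine ⟨hlt, fun i hi => ?_, ?_⟩
    · rcases eq_or_ne i K with rfl | hne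
      · exact hfixK
      · have h1 : k + 1 ≤ i.val := by
          have : i.val ≠ k := fun h => hne (Fin.ext h)
          omega
        have h2 : i ≠ τ K := fun h => by
          have := Fin.lt_def.1 hlt
          rw [← h] at this
          simp only [hK] at this
          omega
        change swap (τ K) K (τ i) = i
        rw [hfix i h1, swap_apply_of_ne_of_ne h2 hne]
    · have h1 := permColength_swap_mul hfixK hlt.ne
      rw [← mul_assoc, swap_mul_self, one_mul, hlen] at h1
      change permColength (swap (τ K) K * τ) = a
      omega
  · rintro ⟨b, σ⟩ h
    rw [Finset.mem_product, mem_permsBelow] at h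
    have hσK : σ K = K := h.2.1 K le_rfl
    have h1 : (swap b K * σ) K = b := by rw [Perm.mul_apply, hσK, swap_apply_right]
    simp only [h1]
    rw [← mul_assoc, swap_mul_self, one_mul]
  · intro τ _
    simp only
    rw [← mul_assoc, swap_mul_self, one_mul]
  · rintro ⟨b, σ⟩ _
    simp [MonoidAlgebra.single_mul_single]

/-- `e_a(𝒥_1, …, 𝒥_k)` is the sum of the permutations of colength `a` that move only the first `k`
points. -/
theorem substJM_sum_powersetCard (n : ℕ) : ∀ k ≤ n, ∀ a,
    substJM n (∑ t ∈ (Finset.univ.filter fun i : Fin n => i.val < k).powersetCard a,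
      ∏ i ∈ t, MvPolynomial.X i) = ∑ σ ∈ permsBelow n k a, MonoidAlgebra.single σ 1 := by
  intro k
  induction k with
  | zero =>
    rintro - (_ | a)
    · rw [permsBelow_zero_right]
      simp [MonoidAlgebra.one_def]
    · have : permsBelow n 0 (a + 1) = ∅ := by
        refine Finset.eq_empty_of_forall_notMem fun σ h => ?_
        rw [mem_permsBelow] at h
        have h1 : σ = 1 := Perm.ext fun i => h.1 i (Nat.zero_le _)
        have h2 := permColength_eq_zero_iff.2 h1
        omega
      have h0 : Finset.powersetCard (a + 1) (∅ : Finset (Fin n)) = ∅ :=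
        Finset.powersetCard_eq_empty.2 (by simp)
      rw [this, Finset.sum_empty]
      simp [h0]
  | succ k ih =>
    rintro hk (_ | a)
    · rw [permsBelow_zero_right]
      simp [MonoidAlgebra.one_def]
    · have hins : (Finset.univ.filter fun i : Fin n => i.val < k + 1) =
          insert ⟨k, hk⟩ (Finset.univ.filter fun i : Fin n => i.val < k) := by
        ext i
        simp only [Finset.mem_filter, Finset.mem_univ, true_and, Finset.mem_insert, Fin.ext_iff]
        omega
      rw [hins, sum_powersetCard_insert_prod _ (by simp), map_add, map_mul, substJM_X,
        ih (by omega), ih (by omega), jucysMurphy_mul_sum_permsBelow hk,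
        ← Finset.sum_filter_add_sum_filter_not (permsBelow n (k + 1) (a + 1))
          (fun σ => σ ⟨k, hk⟩ = ⟨k, hk⟩)]
      congr 1
      refine Finset.sum_congr ?_ fun _ _ => rfl
      ext σ
      rw [Finset.mem_filter, mem_permsBelow, mem_permsBelow]
      constructor
      · rintro ⟨h1, h2⟩
        exact ⟨⟨fun i hi => h1 i (by omega), h2⟩, h1 _ le_rfl⟩
      · rintro ⟨⟨h1, h2⟩, h3⟩
        refine ⟨fun i hi => ?_, h2⟩
        rcases hi.eq_or_lt with h | h
        · rw [show i = ⟨k, hk⟩ from Fin.ext h.symm]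
          exact h3
        · exact h1 i h

theorem colength_eq_permColength {n : ℕ} {μ : n.Partition} {σ : Perm (Fin n)} (h : σ ∈ cyc μ) :
    colength μ = permColength σ := by
  have h' : σ.partition.parts = μ.parts := by simpa [cyc] using h
  have h1 := card_cycleType_le_sum σ
  have h2 := σ.support.card_le_univ
  rw [colength, ← h', Perm.parts_partition, permColength, Perm.sum_cycleType] at *
  simp only [Multiset.card_add, Multiset.card_replicate, Fintype.card_fin] at *
  omega

/-- The cycle type of a permutation of `n` points, as a partition of `n`. -/
def cycleTypePartition {n : ℕ} (σ : Perm (Fin n)) : n.Partition where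
  parts := σ.partition.parts
  parts_pos := σ.partition.parts_pos
  parts_sum := by rw [σ.partition.parts_sum, Fintype.card_fin]

theorem mem_cyc_iff {n : ℕ} {μ : n.Partition} {σ : Perm (Fin n)} :
    σ ∈ cyc μ ↔ cycleTypePartition σ = μ := by
  simp [cyc, Nat.Partition.ext_iff, cycleTypePartition]

/-- Jucys: `e_a(𝒥_1, …, 𝒥_n)` is the sum of all permutations of colength `a`. -/
theorem substJM_esymm (n a : ℕ) :
    substJM n (MvPolynomial.esymm (Fin n) ℂ a) =
      ∑ μ : n.Partition with colength μ = a, cycleSum μ := by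
  have h := substJM_sum_powersetCard n n le_rfl a
  have huniv : (Finset.univ.filter fun i : Fin n => i.val < n) = Finset.univ := by
    ext i; simp
  rw [huniv] at h
  rw [MvPolynomial.esymm, h]
  simp only [cycleSum]
  rw [Finset.sum_sigma']
  refine Finset.sum_bij' (fun σ _ => ⟨cycleTypePartition σ, σ⟩) (fun p _ => p.2) ?_ ?_ ?_ ?_ ?_
  · intro σ hσ
    have h1 : σ ∈ cyc (cycleTypePartition σ) := mem_cyc_iff.2 rfl
    rw [mem_permsBelow] at hσ
    simp [h1, colength_eq_permColength h1, hσ.2]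
  · rintro ⟨μ, σ⟩ hσ
    simp only [Finset.mem_sigma, Finset.mem_filter, Finset.mem_univ, true_and] at hσ
    rw [mem_permsBelow]
    refine ⟨fun i hi => absurd hi (by simp), ?_⟩
    rw [← colength_eq_permColength hσ.2, hσ.1]
  · intro σ _
    rfl
  · rintro ⟨μ, σ⟩ hσ
    simp only [Finset.mem_sigma, Finset.mem_filter, Finset.mem_univ, true_and] at hσ
    rw [mem_cyc_iff] at hσ
    simp [hσ.2]
  · intro σ _
    rfl

/-! ### Newton-type recurrence for the functions `g_j` -/

theorem zPart_eq_prod_of_subset {n : ℕ} (μ : n.Partition) {s : Finset ℕ}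
    (hs : μ.parts.toFinset ⊆ s) :
    zPart μ = ∏ i ∈ s, i ^ μ.parts.count i * (μ.parts.count i).factorial := by
  refine Finset.prod_subset hs fun i _ hi => ?_
  rw [Multiset.mem_toFinset] at hi
  simp [Multiset.count_eq_zero_of_notMem hi]

/-- Inserting a part `a` multiplies `z_ν` by `a (m_a(ν) + 1)`. -/
theorem zPart_of_parts_eq_cons {m n : ℕ} {μ : m.Partition} {ν : n.Partition} {a : ℕ}
    (h : μ.parts = a ::ₘ ν.parts) : zPart μ = a * μ.parts.count a * zPart ν := by
  have h1 : ν.parts.toFinset ⊆ insert a ν.parts.toFinset := Finset.subset_insert _ _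
  have h2 : μ.parts.toFinset ⊆ insert a ν.parts.toFinset := by rw [h, Multiset.toFinset_cons]
  have ha : a ∈ insert a ν.parts.toFinset := Finset.mem_insert_self _ _
  rw [zPart_eq_prod_of_subset μ h2, zPart_eq_prod_of_subset ν h1,
    ← Finset.mul_prod_erase _ _ ha, ← Finset.mul_prod_erase _ _ ha]
  have h3 : ∏ i ∈ (insert a ν.parts.toFinset).erase a,
      i ^ μ.parts.count i * (μ.parts.count i).factorial =
      ∏ i ∈ (insert a ν.parts.toFinset).erase a,
      i ^ ν.parts.count i * (ν.parts.count i).factorial := by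
    refine Finset.prod_congr rfl fun i hi => ?_
    rw [h, Multiset.count_cons_of_ne (Finset.ne_of_mem_erase hi)]
  rw [h3, h, Multiset.count_cons_self, Nat.factorial_succ, pow_succ]
  ring

/-- `∑_{|μ| = m} z_μ⁻¹ ∏_i x_{μ_i}`, the degree `m` part of `exp (∑ x_i / i)`. -/
noncomputable def partitionSum {R : Type*} [CommRing R] [Algebra ℂ R] (x : ℕ → R) (m : ℕ) : R :=
  ∑ μ : m.Partition, (zPart μ : ℂ)⁻¹ • (μ.parts.map x).prod

theorem partitionSum_zero {R : Type*} [CommRing R] [Algebra ℂ R] (x : ℕ → R) :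
    partitionSum x 0 = 1 := by
  simp [partitionSum, zPart]

/-- The recurrence `m s_m = ∑_a x_a s_{m-a}`: count a partition of `m` with the total weight `m`
of its parts, and remove one of them. -/
theorem mul_partitionSum {R : Type*} [CommRing R] [Algebra ℂ R] (x : ℕ → R) (m : ℕ) :
    (m : ℂ) • partitionSum x m = ∑ a ∈ Finset.Icc 1 m, x a * partitionSum x (m - a) := by
  have key : ∀ a ∈ Finset.Icc 1 m, x a * partitionSum x (m - a) =
      ∑ μ : m.Partition, ((a * μ.parts.count a : ℕ) : ℂ) • ((zPart μ : ℂ)⁻¹ •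
        (μ.parts.map x).prod) := by
    intro a ha
    rw [Finset.mem_Icc] at ha
    rw [← Finset.sum_filter_of_ne (p := fun μ : m.Partition => a ∈ μ.parts)]
    · rw [partitionSum, Finset.mul_sum,
        Finset.sum_subtype (p := fun μ : m.Partition => a ∈ μ.parts) _ (by simp)]
      refine Fintype.sum_equiv (Nat.Partition.partitionWithPartEquiv ha.1 ha.2).symm _ _
        fun ν => ?_
      have hparts := Nat.Partition.partitionWithPartEquiv_symm_apply_parts ha.1 ha.2 ν
      set μ := ((Nat.Partition.partitionWithPartEquiv ha.1 ha.2).symm ν).1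
      have hcount : a * μ.parts.count a ≠ 0 := by
        rw [hparts, Multiset.count_cons_self]
        exact mul_ne_zero (by omega) (by omega)
      rw [zPart_of_parts_eq_cons hparts, smul_smul, Nat.cast_mul (a * _), mul_inv, ← mul_assoc,
        mul_inv_cancel₀ (Nat.cast_ne_zero.2 hcount), one_mul, hparts, Multiset.map_cons,
        Multiset.prod_cons, mul_smul_comm]
    · intro μ _ hne
      by_contra h
      rw [Multiset.count_eq_zero_of_notMem h] at hne
      simp at hne
  rw [Finset.sum_congr rfl key, Finset.sum_comm, partitionSum, Finset.smul_sum]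
  refine Finset.sum_congr rfl fun μ _ => ?_
  rw [← Finset.sum_smul, ← Nat.cast_sum]
  congr 2
  conv_lhs => rw [← μ.parts_sum, Finset.sum_multiset_count]
  refine Finset.sum_subset_zero_on_sdiff ?_ ?_ ?_
  · intro i hi
    rw [Multiset.mem_toFinset] at hi
    exact Finset.mem_Icc.2 ⟨μ.parts_pos hi, μ.le_of_mem_parts hi⟩
  · intro i hi
    rw [Finset.mem_sdiff, Multiset.mem_toFinset] at hi
    simp [Multiset.count_eq_zero_of_notMem hi.2]
  · intro i _
    rw [smul_eq_mul, mul_comm]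

/-- The numbers `(1 - t^i) / (1 - q^i)`. -/
noncomputable def qtRatio (q t : ℂ) (i : ℕ) : ℂ := (1 - t ^ i) / (1 - q ^ i)

/-- The conventions `x / 0 = 0` and `0⁻¹ = 0` make this true even where some `1 - q^i` or `1 - t^i`
vanishes. -/
theorem gPoly_eq_partitionSum (n j : ℕ) (q t : ℂ) :
    gPoly n j q t = partitionSum (fun i => qtRatio q t i • MvPolynomial.psum (Fin n) ℂ i) j := by
  rw [gPoly, partitionSum]
  refine Finset.sum_congr rfl fun μ _ => ?_
  rw [← MvPolynomial.smul_eq_C_mul, zqt, mul_inv, mul_smul, MvPolynomial.psumPart]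
  congr 1
  rw [← Multiset.prod_map_inv']
  induction μ.parts using Multiset.induction with
  | empty => simp
  | cons a s ih =>
    simp only [Multiset.map_cons, Multiset.prod_cons, Multiset.map_map] at ih ⊢
    rw [← ih, qtRatio, inv_div]
    simp only [smul_mul_assoc, mul_smul_comm, smul_smul]
    rw [mul_comm (_ / _)]

/-! ### Power series modulo high degrees -/

section PowerSeries

open PowerSeries

variable {R : Type*} [CommRing R]

/-- Equality of power series up to and including degree `j`. -/
def EqUpTo (j : ℕ) (A B : R⟦X⟧) : Prop := ∀ m ≤ j, coeff m A = coeff m B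

theorem EqUpTo.trans {j : ℕ} {A B C : R⟦X⟧} (h : EqUpTo j A B) (h' : EqUpTo j B C) :
    EqUpTo j A C := fun m hm => (h m hm).trans (h' m hm)

theorem EqUpTo.mul_left {j : ℕ} {A B : R⟦X⟧} (h : EqUpTo j A B) (C : R⟦X⟧) :
    EqUpTo j (C * A) (C * B) := by
  intro m hm
  rw [coeff_mul, coeff_mul]
  refine Finset.sum_congr rfl fun p hp => ?_
  have hp' := Finset.HasAntidiagonal.mem_antidiagonal.1 hp
  rw [h p.2 (by omega)]

theorem EqUpTo.mul_right {j : ℕ} {A B : R⟦X⟧} (h : EqUpTo j A B) (C : R⟦X⟧) :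
    EqUpTo j (A * C) (B * C) := by
  rw [mul_comm A, mul_comm B]
  exact h.mul_left C

theorem EqUpTo.rescale {j : ℕ} {A B : R⟦X⟧} (h : EqUpTo j A B) (c : R) :
    EqUpTo j (PowerSeries.rescale c A) (PowerSeries.rescale c B) := by
  intro m hm
  rw [coeff_rescale, coeff_rescale, h m hm]

/-- The Euler derivation `z d/dz`. -/
noncomputable def eulerDeriv (A : R⟦X⟧) : R⟦X⟧ := PowerSeries.mk fun m => (m : R) * coeff m A

theorem coeff_eulerDeriv (A : R⟦X⟧) (m : ℕ) : coeff m (eulerDeriv A) = m * coeff m A :=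
  coeff_mk _ _

theorem eulerDeriv_mul (A B : R⟦X⟧) :
    eulerDeriv (A * B) = eulerDeriv A * B + A * eulerDeriv B := by
  ext m
  rw [coeff_eulerDeriv, map_add, coeff_mul, coeff_mul, coeff_mul, Finset.mul_sum,
    ← Finset.sum_add_distrib]
  refine Finset.sum_congr rfl fun p hp => ?_
  rw [coeff_eulerDeriv, coeff_eulerDeriv, ← Finset.HasAntidiagonal.mem_antidiagonal.1 hp]
  push_cast
  ring

theorem eulerDeriv_rescale (c : R) (A : R⟦X⟧) :
    eulerDeriv (rescale c A) = rescale c (eulerDeriv A) := by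
  ext m
  simp only [coeff_eulerDeriv, coeff_rescale]
  ring

variable [Algebra ℂ R]

theorem natCast_mul_left_cancel {m : ℕ} (hm : m ≠ 0) {x y : R} (h : (m : R) * x = m * y) :
    x = y := by
  have h1 : (m : ℂ) • x = (m : ℂ) • y := by
    rwa [Algebra.smul_def, Algebra.smul_def, map_natCast]
  have h2 : (m : ℂ) ≠ 0 := Nat.cast_ne_zero.2 hm
  have h3 := congrArg (fun z => (m : ℂ)⁻¹ • z) h1
  simpa [smul_smul, h2] using h3

/-- A power series is determined by its constant coefficient and its logarithmic derivative. -/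
theorem eqUpTo_of_eulerDeriv {j : ℕ} {A A' P P' : R⟦X⟧} (hA : eulerDeriv A = A * P)
    (hA' : eulerDeriv A' = A' * P') (hP : EqUpTo j P P') (hP0 : coeff 0 P = 0)
    (h0 : coeff 0 A = coeff 0 A') : EqUpTo j A A' := by
  intro m
  induction m using Nat.strong_induction_on with
  | _ m ih =>
    intro hm
    rcases Nat.eq_zero_or_pos m with rfl | hpos
    · exact h0
    · refine natCast_mul_left_cancel hpos.ne' ?_
      rw [← coeff_eulerDeriv, ← coeff_eulerDeriv, hA, hA', coeff_mul, coeff_mul]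
      refine Finset.sum_congr rfl fun p hp => ?_
      have hp' := Finset.HasAntidiagonal.mem_antidiagonal.1 hp
      rw [← hP p.2 (by omega)]
      rcases Nat.eq_zero_or_pos p.2 with h | h
      · rw [h, hP0, mul_zero, mul_zero]
      · rw [ih p.1 (by omega) (by omega)]

/-- Uniqueness for the `q`-difference equation `A(z) U(z) = A(qz) V(z)`. -/
theorem eqUpTo_of_qDifference {j : ℕ} {q : ℂ} (hq : ∀ m : ℕ, 1 ≤ m → m ≤ j → q ^ m ≠ 1)
    {A B U V : R⟦X⟧} (hA : EqUpTo j (A * U) (rescale (algebraMap ℂ R q) A * V))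
    (hB : EqUpTo j (B * U) (rescale (algebraMap ℂ R q) B * V))
    (hU : coeff 0 U = 1) (hV : coeff 0 V = 1) (h0 : coeff 0 A = coeff 0 B) : EqUpTo j A B := by
  suffices h : ∀ m ≤ j, coeff m (A - B) = 0 by
    intro m hm
    have := h m hm
    rwa [map_sub, sub_eq_zero] at this
  have hD : EqUpTo j ((A - B) * U) (rescale (algebraMap ℂ R q) (A - B) * V) := by
    intro m hm
    rw [sub_mul, map_sub, map_sub, sub_mul, map_sub, hA m hm, hB m hm]
  intro m
  induction m using Nat.strong_induction_on with
  | _ m ih =>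
    intro hm
    rcases Nat.eq_zero_or_pos m with rfl | hpos
    · rw [map_sub, h0, sub_self]
    · have h1 := hD m hm
      have hlow : ∀ p ∈ Finset.HasAntidiagonal.antidiagonal m, p ≠ (m, 0) → coeff p.1 (A - B) = 0 := by
        intro p hp hne
        have hp' := Finset.HasAntidiagonal.mem_antidiagonal.1 hp
        have : p.1 ≠ m := fun h => hne (Prod.ext h (by simp only; omega))
        exact ih p.1 (by omega) (by omega)
      rw [coeff_mul, coeff_mul, Finset.sum_eq_single (m, 0), Finset.sum_eq_single (m, 0),
        hU, hV, mul_one, mul_one, coeff_rescale, ← map_pow, ← Algebra.smul_def] at h1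
      · have h2 : (1 - q ^ m) • coeff m (A - B) = 0 := by
          rw [sub_smul, one_smul, sub_eq_zero]
          exact h1
        have h3 : (1 - q ^ m) ≠ 0 := sub_ne_zero.2 (hq m hpos hm).symm
        have h4 := congrArg (fun z => (1 - q ^ m)⁻¹ • z) h2
        simpa only [smul_smul, inv_mul_cancel₀ h3, one_smul, smul_zero] using h4
      · intro p hp hne
        rw [coeff_rescale, hlow p hp hne, mul_zero, zero_mul]
      · simp
      · intro p hp hne
        rw [hlow p hp hne, zero_mul]
      · simp

theorem sum_antidiagonal_eq_add_sum_Icc {M : Type*} [AddCommMonoid M] (m : ℕ) (f : ℕ × ℕ → M) :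
    ∑ p ∈ Finset.HasAntidiagonal.antidiagonal m, f p = f (0, m) + ∑ a ∈ Finset.Icc 1 m, f (a, m - a) := by
  rw [Finset.Nat.sum_antidiagonal_eq_sum_range_succ_mk, Finset.range_eq_Ico,
    Finset.sum_eq_sum_Ico_succ_bot (Nat.succ_pos m)]
  rfl

/-! ### Sums over compositions with multiplicative weights -/

/-- The sum over the compositions `m = a_1 + ⋯ + a_k` into positive parts of
`(∏_u r(a_1 + ⋯ + a_u, a_u)) e_{a_1} ⋯ e_{a_k}`, by recursion on the last part. -/
noncomputable def compSum {A : Type*} [Ring A] [Algebra ℂ A] (r : ℕ → ℕ → ℂ) (e : ℕ → A) :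
    ℕ → ℕ → A
  | 0, m => if m = 0 then 1 else 0
  | k + 1, m => ∑ a ∈ Finset.Icc 1 m, r m a • (compSum r e k (m - a) * e a)

theorem compSum_eq_zero (r : ℕ → ℕ → ℂ) (e : ℕ → R) :
    ∀ {k m : ℕ}, m < k → compSum r e k m = 0 := by
  intro k
  induction k with
  | zero => intro m h; omega
  | succ k ih =>
    intro m h
    rw [compSum]
    refine Finset.sum_eq_zero fun a ha => ?_
    rw [Finset.mem_Icc] at ha
    rw [ih (by omega), zero_mul, smul_zero]

theorem map_compSum {A B : Type*} [Ring A] [Algebra ℂ A] [Ring B] [Algebra ℂ B] (f : A →ₐ[ℂ] B)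
    (r : ℕ → ℕ → ℂ) (e : ℕ → A) (k : ℕ) : ∀ m,
    f (compSum r e k m) = compSum r (fun a => f (e a)) k m := by
  induction k with
  | zero => intro m; simp [compSum, apply_ite f]
  | succ k ih => intro m; simp [compSum, ih]

/-- The sum of `compSum` over all lengths. -/
noncomputable def compTotal {A : Type*} [Ring A] [Algebra ℂ A] (r : ℕ → ℕ → ℂ) (e : ℕ → A)
    (m : ℕ) : A :=
  ∑ k ∈ Finset.range (m + 1), compSum r e k m

theorem compTotal_zero (r : ℕ → ℕ → ℂ) (e : ℕ → R) : compTotal r e 0 = 1 := by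
  simp [compTotal, compSum]

/-- Splitting off the last part of a composition. -/
theorem compTotal_eq (r : ℕ → ℕ → ℂ) (e : ℕ → R) {m : ℕ} (hm : 1 ≤ m) :
    compTotal r e m = ∑ a ∈ Finset.Icc 1 m, r m a • (compTotal r e (m - a) * e a) := by
  have h0 : compSum r e 0 m = 0 := if_neg (by omega)
  rw [compTotal, Finset.sum_range_succ', h0, add_zero]
  simp only [compSum]
  rw [Finset.sum_comm]
  refine Finset.sum_congr rfl fun a ha => ?_
  rw [Finset.mem_Icc] at ha
  rw [← Finset.smul_sum, ← Finset.sum_mul, compTotal]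
  congr 2
  refine (Finset.sum_subset ?_ ?_).symm
  · intro k hk
    rw [Finset.mem_range] at hk ⊢
    omega
  · intro k _ hk
    rw [Finset.mem_range] at hk
    exact compSum_eq_zero r e (by omega)

/-- The factor contributed to `W_{E(q)}` by a last part `a` of a composition of `m`. -/
noncomputable def ratioE (q : ℂ) (m a : ℕ) : ℂ := q ^ (m - a) / (1 - q ^ m)

/-- The factor contributed to `W_{H(q)}`, sign included, by a last part `a` of a composition
of `m`. -/
noncomputable def ratioH (q : ℂ) (m a : ℕ) : ℂ := -(-1) ^ a / (1 - q ^ m)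

/-- `F(z) = E(z) F(qz)` for the series `F` with coefficients `compTotal (ratioE q) e`. -/
theorem compTotal_ratioE_qDifference {j : ℕ} {q : ℂ} (hq : ∀ m : ℕ, 1 ≤ m → m ≤ j → q ^ m ≠ 1)
    (e : ℕ → R) (he : e 0 = 1) :
    EqUpTo j (PowerSeries.mk (compTotal (ratioE q) e))
      (PowerSeries.mk e *
        rescale (algebraMap ℂ R q) (PowerSeries.mk (compTotal (ratioE q) e))) := by
  intro m hm
  rw [coeff_mul, sum_antidiagonal_eq_add_sum_Icc]
  simp only [coeff_rescale, coeff_mk, he, one_mul, ← map_pow, ← Algebra.smul_def]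
  rcases Nat.eq_zero_or_pos m with rfl | hpos
  · simp
  · have h1 : (1 - q ^ m) ≠ 0 := sub_ne_zero.2 (hq m hpos hm).symm
    have h2 : (1 - q ^ m) • compTotal (ratioE q) e m =
        ∑ a ∈ Finset.Icc 1 m, e a * q ^ (m - a) • compTotal (ratioE q) e (m - a) := by
      rw [compTotal_eq _ _ hpos, Finset.smul_sum]
      refine Finset.sum_congr rfl fun a _ => ?_
      rw [smul_smul, ratioE, mul_div_cancel₀ _ h1, mul_smul_comm, mul_comm (e a)]
    rw [← h2, sub_smul, one_smul, add_sub_cancel]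

/-- `B(z) E(-z) = B(qz)` for the series `B` with coefficients `compTotal (ratioH q) e`. -/
theorem compTotal_ratioH_qDifference {j : ℕ} {q : ℂ} (hq : ∀ m : ℕ, 1 ≤ m → m ≤ j → q ^ m ≠ 1)
    (e : ℕ → R) (he : e 0 = 1) :
    EqUpTo j (PowerSeries.mk (compTotal (ratioH q) e) * rescale (-1) (PowerSeries.mk e))
      (rescale (algebraMap ℂ R q) (PowerSeries.mk (compTotal (ratioH q) e))) := by
  intro m hm
  rw [mul_comm, coeff_mul, sum_antidiagonal_eq_add_sum_Icc]
  simp only [coeff_rescale, coeff_mk, he, one_mul, ← map_pow, ← Algebra.smul_def, pow_zero]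
  rcases Nat.eq_zero_or_pos m with rfl | hpos
  · simp
  · have h1 : (1 - q ^ m) ≠ 0 := sub_ne_zero.2 (hq m hpos hm).symm
    have h2 : (1 - q ^ m) • compTotal (ratioH q) e m =
        -∑ a ∈ Finset.Icc 1 m, (-1) ^ a * e a * compTotal (ratioH q) e (m - a) := by
      rw [compTotal_eq _ _ hpos, Finset.smul_sum, ← Finset.sum_neg_distrib]
      refine Finset.sum_congr rfl fun a _ => ?_
      rw [smul_smul, ratioH, mul_div_cancel₀ _ h1, Algebra.smul_def]
      simp only [map_neg, map_pow, map_one]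
      ring
    rw [← neg_eq_iff_eq_neg.2 h2, sub_smul, one_smul]
    abel

/-! ### Factorization of `g_j` -/

/-- `G(z) E(-z) = G(qz) E(-tz)` for the generating series `G` of the `g_m` and `E` of the
elementary symmetric functions: both sides have the same logarithmic derivative by Newton's
identities for `E`. -/
theorem partitionSum_qDifference {j : ℕ} {q t : ℂ} (hq : ∀ m : ℕ, 1 ≤ m → m ≤ j → q ^ m ≠ 1)
    (e p : ℕ → R) (he : e 0 = 1)
    (hnewton : eulerDeriv (rescale (-1) (PowerSeries.mk e)) =
      rescale (-1) (PowerSeries.mk e) * -PowerSeries.mk fun i => if i = 0 then 0 else p i) :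
    EqUpTo j
      (PowerSeries.mk (partitionSum fun i => qtRatio q t i • p i) * rescale (-1) (PowerSeries.mk e))
      (rescale (algebraMap ℂ R q) (PowerSeries.mk (partitionSum fun i => qtRatio q t i • p i)) *
        rescale (algebraMap ℂ R (-t)) (PowerSeries.mk e)) := by
  set x : ℕ → R := fun i => qtRatio q t i • p i with hx
  set G : R⟦X⟧ := PowerSeries.mk (partitionSum x) with hG
  set E' : R⟦X⟧ := rescale (-1) (PowerSeries.mk e) with hE'
  set Q : R⟦X⟧ := PowerSeries.mk fun i => if i = 0 then 0 else p i with hQ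
  set Y : R⟦X⟧ := PowerSeries.mk fun i => if i = 0 then 0 else x i with hY
  have hEt : rescale (algebraMap ℂ R (-t)) (PowerSeries.mk e) = rescale (algebraMap ℂ R t) E' := by
    rw [hE', rescale_rescale, map_neg, neg_one_mul]
  have hGd : eulerDeriv G = G * Y := by
    ext m
    rw [coeff_eulerDeriv, mul_comm G, coeff_mul, sum_antidiagonal_eq_add_sum_Icc]
    have h := mul_partitionSum x m
    rw [Algebra.smul_def, map_natCast] at h
    simp only [hG, hY, coeff_mk, if_true, zero_mul, zero_add, h]
    refine Finset.sum_congr rfl fun a ha => ?_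
    rw [Finset.mem_Icc] at ha
    rw [if_neg (by omega)]
  rw [hEt]
  -- With `x_m = (1 - t^m) / (1 - q^m) p_m`, the logarithmic derivatives `x_m - p_m` and
  -- `q^m x_m - t^m p_m` agree in every degree `m` where `q^m ≠ 1`.
  refine eqUpTo_of_eulerDeriv (P := Y - Q)
    (P' := rescale (algebraMap ℂ R q) Y - rescale (algebraMap ℂ R t) Q) ?_ ?_ ?_ ?_ ?_
  · rw [eulerDeriv_mul, hGd, hnewton]
    ring
  · rw [eulerDeriv_mul, eulerDeriv_rescale, eulerDeriv_rescale, hGd, hnewton, map_mul, map_mul,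
      map_neg]
    ring
  · intro m hm
    rcases Nat.eq_zero_or_pos m with rfl | hpos
    · simp only [map_sub, coeff_rescale, hY, hQ, coeff_mk, if_true, mul_zero]
    · have h1 : (1 - q ^ m) ≠ 0 := sub_ne_zero.2 (hq m hpos hm).symm
      simp only [map_sub, coeff_rescale, hY, hQ, coeff_mk, if_neg hpos.ne', hx, ← map_pow,
        ← Algebra.smul_def, smul_smul]
      nth_rewrite 2 [← one_smul ℂ (p m)]
      rw [← sub_smul, ← sub_smul, qtRatio]
      congr 1
      field_simp
      ring
  · simp [hY, hQ]
  · simp [coeff_mul, coeff_rescale, hG, hE', he, partitionSum_zero]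

/-- `G(z) = F(-tz) B(z)`, as both sides solve the same `q`-difference equation. -/
theorem partitionSum_eq_sum_compTotal {j : ℕ} {q t : ℂ}
    (hq : ∀ m : ℕ, 1 ≤ m → m ≤ j → q ^ m ≠ 1)
    (e p : ℕ → R) (he : e 0 = 1)
    (hnewton : eulerDeriv (rescale (-1) (PowerSeries.mk e)) =
      rescale (-1) (PowerSeries.mk e) * -PowerSeries.mk fun i => if i = 0 then 0 else p i) :
    partitionSum (fun i => qtRatio q t i • p i) j =
      ∑ a ∈ Finset.range (j + 1),
        (-t) ^ a • (compTotal (ratioE q) e a * compTotal (ratioH q) e (j - a)) := by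
  have hG := partitionSum_qDifference (t := t) hq e p he hnewton
  set F : R⟦X⟧ := PowerSeries.mk (compTotal (ratioE q) e) with hF
  set B : R⟦X⟧ := PowerSeries.mk (compTotal (ratioH q) e) with hB
  have hX : EqUpTo j (rescale (algebraMap ℂ R (-t)) F * B * rescale (-1) (PowerSeries.mk e))
      (rescale (algebraMap ℂ R q) (rescale (algebraMap ℂ R (-t)) F * B) *
        rescale (algebraMap ℂ R (-t)) (PowerSeries.mk e)) := by
    have h1 := (compTotal_ratioH_qDifference hq e he).mul_left (rescale (algebraMap ℂ R (-t)) F)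
    have h2 := ((compTotal_ratioE_qDifference hq e he).rescale (algebraMap ℂ R (-t))).mul_right
      (rescale (algebraMap ℂ R q) B)
    rw [← mul_assoc] at h1
    refine (h1.trans h2).trans fun m _ => congrArg (coeff m) ?_
    rw [map_mul, map_mul, rescale_rescale, rescale_rescale,
      mul_comm (algebraMap ℂ R q)]
    ring
  have h := eqUpTo_of_qDifference hq hG hX (by simp [coeff_rescale, he])
    (by simp [coeff_rescale, he])
    (by simp [coeff_mul, coeff_rescale, hF, hB, compTotal_zero, partitionSum_zero]) j le_rfl
  rw [coeff_mk] at h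
  rw [h, coeff_mul, Finset.Nat.sum_antidiagonal_eq_sum_range_succ_mk]
  refine Finset.sum_congr rfl fun a _ => ?_
  simp only [coeff_rescale, hF, hB, coeff_mk, ← map_pow]
  rw [← Algebra.smul_def, smul_mul_assoc]

end PowerSeries

/-- Newton's identities: `-∑ p_i z^i` is the logarithmic derivative of `E(-z)`. -/
theorem esymm_newton (n : ℕ) :
    eulerDeriv (PowerSeries.rescale (-1) (PowerSeries.mk (MvPolynomial.esymm (Fin n) ℂ))) =
      PowerSeries.rescale (-1) (PowerSeries.mk (MvPolynomial.esymm (Fin n) ℂ)) *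
        -PowerSeries.mk fun i => if i = 0 then 0 else MvPolynomial.psum (Fin n) ℂ i := by
  ext1 m
  rw [coeff_eulerDeriv, PowerSeries.coeff_rescale, PowerSeries.coeff_mk, PowerSeries.coeff_mul,
    mul_left_comm, MvPolynomial.mul_esymm_eq_sum, ← mul_assoc, ← pow_add, Finset.sum_filter,
    Finset.mul_sum]
  refine Finset.sum_congr rfl fun p hp => ?_
  have hp' := Finset.HasAntidiagonal.mem_antidiagonal.1 hp
  have hodd : (-1 : MvPolynomial (Fin n) ℂ) ^ (m + (m + 1)) = -1 :=
    Odd.neg_one_pow ⟨m, by ring⟩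
  rw [hodd, PowerSeries.coeff_rescale, map_neg, PowerSeries.coeff_mk, PowerSeries.coeff_mk]
  rcases Nat.eq_zero_or_pos p.2 with h | h
  · rw [if_neg (by omega), if_pos h]
    ring
  · rw [if_pos (by omega), if_neg h.ne']
    ring

theorem gPoly_eq_sum_compTotal (n j : ℕ) (q t : ℂ)
    (hq : ∀ m : ℕ, 1 ≤ m → m ≤ j → q ^ m ≠ 1) :
    gPoly n j q t = ∑ a ∈ Finset.range (j + 1), (-t) ^ a •
      (compTotal (ratioE q) (MvPolynomial.esymm (Fin n) ℂ) a *
        compTotal (ratioH q) (MvPolynomial.esymm (Fin n) ℂ) (j - a)) := by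
  rw [gPoly_eq_partitionSum]
  exact partitionSum_eq_sum_compTotal hq _ _ (MvPolynomial.esymm_zero _ _) (esymm_newton n)

/-! ### Symmetrized sums over families -/

/-- Any two weakly decreasing rearrangements of `c` coincide, so their number is the order of the
stabilizer of `c`. -/
theorem card_antitone_rearrangements {k : ℕ} (c : Fin k → ℕ) :
    (Finset.univ.filter fun σ : Perm (Fin k) => Antitone (c ∘ σ)).card =
      (Finset.univ.filter fun τ : Perm (Fin k) => c ∘ τ = c).card := by
  obtain ⟨s, hs⟩ : ∃ s : Perm (Fin k), Antitone (c ∘ s) := by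
    refine ⟨Tuple.sort (OrderDual.toDual ∘ c), ?_⟩
    exact Tuple.monotone_sort (OrderDual.toDual ∘ c)
  refine Finset.card_bij' (fun σ _ => σ * s⁻¹) (fun τ _ => τ * s) ?_ ?_ ?_ ?_
  · intro σ hσ
    rw [Finset.mem_filter] at hσ ⊢
    have h : c ∘ σ = c ∘ s := Tuple.unique_antitone hσ.2 hs
    refine ⟨Finset.mem_univ _, funext fun u => ?_⟩
    have := congrFun h (s⁻¹ u)
    simpa using this
  · intro τ hτ
    rw [Finset.mem_filter] at hτ ⊢
    refine ⟨Finset.mem_univ _, ?_⟩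
    have : c ∘ (τ * s : Perm (Fin k)) = c ∘ s := by
      rw [Perm.coe_mul, ← Function.comp_assoc, hτ.2]
    rw [this]
    exact hs
  · intro σ _
    simp
  · intro τ _
    simp

theorem card_stabilizer_eq_autOrder {n k : ℕ} (μ : Fin k → n.Partition) :
    (Finset.univ.filter fun τ : Perm (Fin k) =>
      (fun u => colength (μ u)) ∘ τ = fun u => colength (μ u)).card = autOrder μ := by
  rw [← Fintype.card_subtype, DomMulAct.stabilizer_card']
  rw [autOrder]
  refine Finset.prod_congr ?_ fun i _ => ?_
  · ext i
    simp
  · rw [Fintype.card_subtype, Multiset.count_map]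
    congr 1
    simp [Finset.card_def, Finset.filter_val, eq_comm]

/-- A sum over all families equals the symmetrized sum over the families with weakly decreasing
colengths, divided by the orders of the stabilizers. -/
theorem sum_antitone_symmetrize {n k : ℕ} {M : Type*} [AddCommGroup M] [Module ℂ M]
    (P : (Fin k → n.Partition) → Prop) [DecidablePred P]
    (hP : ∀ μ (σ : Perm (Fin k)), P (μ ∘ σ) ↔ P μ) (Φ : (Fin k → n.Partition) → M) :
    ∑ μ with P μ ∧ Antitone (fun u => colength (μ u)),
      (autOrder μ : ℂ)⁻¹ • ∑ σ : Perm (Fin k), Φ (μ ∘ σ) = ∑ μ with P μ, Φ μ := by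
  have haut : ∀ (μ : Fin k → n.Partition) (σ : Perm (Fin k)), autOrder (μ ∘ σ) = autOrder μ := by
    intro μ σ
    have : (Finset.univ.val.map fun u => colength ((μ ∘ σ) u)) =
        (Finset.univ.val.map fun u => colength (μ u)) := by
      conv_rhs => rw [← Finset.map_univ_equiv σ, Finset.map_val, Multiset.map_map]
      rfl
    simp only [autOrder, this]
  simp_rw [Finset.smul_sum]
  rw [Finset.sum_comm]
  have h1 : ∀ σ : Perm (Fin k),
      ∑ μ with P μ ∧ Antitone (fun u => colength (μ u)), (autOrder μ : ℂ)⁻¹ • Φ (μ ∘ σ) =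
      ∑ ν with P ν, if Antitone ((fun u => colength (ν u)) ∘ (σ⁻¹ : Perm (Fin k))) then
        (autOrder ν : ℂ)⁻¹ • Φ ν else 0 := by
    intro σ
    rw [← Finset.sum_filter, Finset.filter_filter]
    refine Finset.sum_bij' (fun μ _ => μ ∘ σ) (fun ν _ => ν ∘ (σ⁻¹ : Perm (Fin k))) ?_ ?_ ?_ ?_ ?_
    · intro μ hμ
      simp only [Finset.mem_filter, Finset.mem_univ, true_and] at hμ ⊢
      refine ⟨(hP _ _).2 hμ.1, ?_⟩
      convert hμ.2 using 1
      ext u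
      simp
    · intro ν hν
      simp only [Finset.mem_filter, Finset.mem_univ, true_and] at hν ⊢
      exact ⟨(hP _ _).2 hν.1, hν.2⟩
    · intro μ _
      ext1 u
      simp
    · intro ν _
      ext1 u
      simp
    · intro μ _
      rw [haut]
  -- A family `ν` now occurs once for each rearrangement that makes it weakly decreasing.
  simp_rw [h1]
  rw [Finset.sum_comm]
  refine Finset.sum_congr rfl fun ν _ => ?_
  have hcard : (Finset.univ.filter fun σ : Perm (Fin k) =>
      Antitone ((fun u => colength (ν u)) ∘ (σ⁻¹ : Perm (Fin k)))).card = autOrder ν := by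
    rw [← card_stabilizer_eq_autOrder, ← card_antitone_rearrangements]
    refine Finset.card_bij' (fun σ _ => σ⁻¹) (fun σ _ => σ⁻¹) ?_ ?_ (fun σ _ => inv_inv σ)
      fun σ _ => inv_inv σ
    · intro σ hσ
      rw [Finset.mem_filter] at hσ ⊢
      exact ⟨Finset.mem_univ _, hσ.2⟩
    · intro σ hσ
      rw [Finset.mem_filter] at hσ ⊢
      rw [inv_inv]
      exact ⟨Finset.mem_univ _, hσ.2⟩
  have hne : (autOrder ν : ℂ) ≠ 0 := by
    rw [Nat.cast_ne_zero, autOrder]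
    exact Finset.prod_ne_zero_iff.2 fun i _ => Nat.factorial_ne_zero _
  rw [← Finset.sum_filter, Finset.sum_const, hcard, ← Nat.cast_smul_eq_nsmul ℂ, smul_smul,
    mul_inv_cancel₀ hne, one_smul]

/-- The weight `∏_u r(c_1 + ⋯ + c_u, c_u)` of a composition. -/
noncomputable def recWeight (r : ℕ → ℕ → ℂ) : (k : ℕ) → (Fin k → ℕ) → ℂ
  | 0, _ => 1
  | k + 1, c => r (∑ u, c u) (c (Fin.last k)) * recWeight r k (fun u => c u.castSucc)

/-- If `e_a` is the sum of the `C x` with `l x = a`, expanding the products `e_{a_1} ⋯ e_{a_k}` turns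
the sum over compositions into a sum over families. -/
theorem compSum_eq_sum_families {ι A : Type*} [Fintype ι] [CommRing A] [Algebra ℂ A]
    (r : ℕ → ℕ → ℂ) (C : ι → A) (l : ι → ℕ) (k : ℕ) : ∀ m,
    compSum r (fun a => ∑ x with l x = a, C x) k m =
      ∑ μ : Fin k → ι with (∀ u, l (μ u) ≠ 0) ∧ ∑ u, l (μ u) = m,
        recWeight r k (fun u => l (μ u)) • ∏ u, C (μ u) := by
  induction k with
  | zero =>
    intro m
    rw [Finset.sum_filter]
    simp [compSum, recWeight, eq_comm]
  | succ k ih =>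
    intro m
    rw [compSum]
    have h1 : ∀ a ∈ Finset.Icc 1 m,
        r m a • (compSum r (fun a => ∑ x with l x = a, C x) k (m - a) * ∑ x with l x = a, C x) =
        ∑ x, if l x = a then (if l x ∈ Finset.Icc 1 m then
          r m (l x) • (compSum r (fun a => ∑ x with l x = a, C x) k (m - l x) * C x) else 0)
          else 0 := by
      intro a ha
      rw [Finset.mul_sum, Finset.smul_sum, Finset.sum_filter]
      refine Finset.sum_congr rfl fun x _ => ?_
      by_cases hx : l x = a
      · rw [if_pos hx, if_pos hx, hx, if_pos ha]
      · rw [if_neg hx, if_neg hx]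
    rw [Finset.sum_congr rfl h1, Finset.sum_filter, ← Equiv.sum_comp (Fin.snocEquiv fun _ => ι),
      Fintype.sum_prod_type]
    have h2 : ∀ x : ι, ∑ a ∈ Finset.Icc 1 m, (if l x = a then (if l x ∈ Finset.Icc 1 m then
        r m (l x) • (compSum r (fun a => ∑ x with l x = a, C x) k (m - l x) * C x) else 0) else 0)
        = if l x ∈ Finset.Icc 1 m then
        r m (l x) • (compSum r (fun a => ∑ x with l x = a, C x) k (m - l x) * C x) else 0 := by
      intro x
      rw [Finset.sum_ite_eq]
      split_ifs <;> rfl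
    rw [Finset.sum_comm]
    refine Finset.sum_congr rfl fun x _ => ?_
    rw [h2]
    have hsnoc : ∀ μ : Fin k → ι,
        Fin.snocEquiv (fun _ => ι) (x, μ) = Fin.snoc (α := fun _ => ι) μ x := fun μ => rfl
    simp only [hsnoc, Fin.forall_fin_succ', Fin.sum_univ_castSucc, Fin.prod_univ_castSucc,
      Fin.snoc_castSucc, Fin.snoc_last, recWeight]
    split_ifs with hx
    · rw [Finset.mem_Icc] at hx
      rw [ih, Finset.sum_filter, Finset.sum_mul, Finset.smul_sum]
      refine Finset.sum_congr rfl fun μ _ => ?_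
      by_cases hμ : (∀ u, l (μ u) ≠ 0) ∧ ∑ u, l (μ u) = m - l x
      · have h3 : ∑ u, l (μ u) + l x = m := by omega
        rw [if_pos hμ, if_pos ⟨⟨hμ.1, by omega⟩, h3⟩, h3, smul_mul_assoc, smul_smul]
      · rw [if_neg hμ, if_neg, zero_mul, smul_zero]
        rintro ⟨⟨h4, h5⟩, h6⟩
        exact hμ ⟨h4, by omega⟩
    · refine (Finset.sum_eq_zero fun μ _ => if_neg ?_).symm
      rintro ⟨⟨h4, h5⟩, h6⟩
      exact hx (Finset.mem_Icc.2 ⟨by omega, by omega⟩)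

/-- The common form of the two weights: `δ = 1` for `W_{E(q)}` and `δ = 0` for `W_{H(q)}`. -/
noncomputable def compWeight (δ : ℕ) (q : ℂ) {k : ℕ} (c : Fin k → ℕ) : ℂ :=
  (∏ u : Fin k, q ^ (δ * (u.rev : ℕ) * c u)) / ∏ u : Fin k, (1 - ∏ v ∈ Finset.Iic u, q ^ c v)

/-- Splitting off the last part; no condition on `q` is needed, since inversion is
multiplicative also at `0`. -/
theorem compWeight_succ (δ : ℕ) (q : ℂ) {k : ℕ} (c : Fin (k + 1) → ℕ) :
    compWeight δ q c = q ^ (δ * ∑ u : Fin k, c u.castSucc) / (1 - q ^ ∑ u, c u) *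
      compWeight δ q fun u => c u.castSucc := by
  have hnum : ∏ u : Fin (k + 1), q ^ (δ * (u.rev : ℕ) * c u) =
      q ^ (δ * ∑ u : Fin k, c u.castSucc) *
        ∏ u : Fin k, q ^ (δ * (u.rev : ℕ) * c u.castSucc) := by
    rw [Fin.prod_univ_castSucc, Finset.prod_pow_eq_pow_sum, Finset.prod_pow_eq_pow_sum,
      Fin.rev_last, Fin.val_zero, mul_zero, zero_mul, pow_zero, mul_one, ← pow_add,
      Finset.mul_sum, ← Finset.sum_add_distrib]
    congr 1
    refine Finset.sum_congr rfl fun u _ => ?_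
    rw [Fin.rev_castSucc, Fin.val_succ]
    ring
  have hlast : ∏ v ∈ Finset.Iic (Fin.last k), q ^ c v = q ^ ∑ u, c u := by
    rw [← Finset.prod_pow_eq_pow_sum]
    congr 1
    ext u
    simp [Fin.le_last]
  have hcast : ∀ u : Fin k, ∏ v ∈ Finset.Iic u.castSucc, q ^ c v =
      ∏ v ∈ Finset.Iic u, q ^ c v.castSucc := by
    intro u
    rw [← Fin.map_castSuccEmb_Iic, Finset.prod_map]
    rfl
  rw [compWeight, hnum, Fin.prod_univ_castSucc, hlast, compWeight]
  simp_rw [hcast]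
  rw [div_mul_div_comm]
  congr 1
  ring

theorem recWeight_ratioE (q : ℂ) (k : ℕ) : ∀ c : Fin k → ℕ,
    recWeight (ratioE q) k c = compWeight 1 q c := by
  induction k with
  | zero => intro c; simp [recWeight, compWeight]
  | succ k ih =>
    intro c
    rw [recWeight, compWeight_succ, ih, ratioE, one_mul, Fin.sum_univ_castSucc,
      Nat.add_sub_cancel]

theorem recWeight_ratioH (q : ℂ) (k : ℕ) : ∀ c : Fin k → ℕ, (∀ u, c u ≠ 0) →
    recWeight (ratioH q) k c = (-1) ^ (∑ u, c u - k) * compWeight 0 q c := by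
  induction k with
  | zero => intro c _; simp [recWeight, compWeight]
  | succ k ih =>
    intro c hc
    have h1 : k ≤ ∑ u : Fin k, c u.castSucc := by
      have := Finset.card_nsmul_le_sum Finset.univ (fun u : Fin k => c u.castSucc) 1
        fun u _ => Nat.one_le_iff_ne_zero.2 (hc _)
      simpa using this
    have h2 := hc (Fin.last k)
    obtain ⟨b, hb⟩ := Nat.exists_eq_succ_of_ne_zero h2
    rw [recWeight, compWeight_succ, ih _ fun u => hc _, ratioH, zero_mul, pow_zero]
    have h3 : ∑ u, c u - (k + 1) = (∑ u : Fin k, c u.castSucc - k) + b := by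
      rw [Fin.sum_univ_castSucc]
      omega
    rw [h3, pow_add, hb, Nat.succ_eq_add_one, pow_succ]
    ring

/-! ### The expansion with rational weights -/

theorem inv_mul_mul_mem_cyc_iff {n : ℕ} {μ : n.Partition} (g h : Perm (Fin n)) :
    g⁻¹ * h * g ∈ cyc μ ↔ h ∈ cyc μ := by
  have hc : IsConj h (g⁻¹ * h * g) := isConj_iff.2 ⟨g⁻¹, by rw [inv_inv]⟩
  simp only [cyc, Finset.mem_filter, Finset.mem_univ, true_and, Perm.partition_eq_of_isConj.1 hc]

theorem cycleSum_mem_center {n : ℕ} (μ : n.Partition) :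
    cycleSum μ ∈ Subalgebra.center ℂ (GroupAlg n) := by
  rw [Subalgebra.mem_center_iff]
  intro x
  induction x using MonoidAlgebra.induction_linear with
  | zero => rw [zero_mul, mul_zero]
  | add x y hx hy => rw [add_mul, mul_add, hx, hy]
  | single g c =>
    rw [cycleSum, Finset.mul_sum, Finset.sum_mul]
    refine Finset.sum_bij' (fun h _ => g * h * g⁻¹) (fun h _ => g⁻¹ * h * g) ?_ ?_ ?_ ?_ ?_
    · intro h hh
      have := inv_mul_mul_mem_cyc_iff (μ := μ) g⁻¹ h
      rw [inv_inv] at this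
      exact this.2 hh
    · intro h hh
      exact (inv_mul_mul_mem_cyc_iff g h).2 hh
    · intro h _
      group
    · intro h _
      group
    · intro h _
      rw [MonoidAlgebra.single_mul_single, MonoidAlgebra.single_mul_single, mul_one, one_mul,
        inv_mul_cancel_right]

/-- `C_μ` as an element of the center. -/
noncomputable def cycleSumCenter {n : ℕ} (μ : n.Partition) : Subalgebra.center ℂ (GroupAlg n) :=
  ⟨cycleSum μ, cycleSum_mem_center μ⟩

theorem prod_ofFn_cycleSum {n k : ℕ} (μ : Fin k → n.Partition) :
    (List.ofFn fun u => cycleSum (μ u)).prod = ((∏ u, cycleSumCenter (μ u) :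
      Subalgebra.center ℂ (GroupAlg n)) : GroupAlg n) := by
  rw [← List.prod_ofFn, ← Subalgebra.coe_val, map_list_prod, List.map_ofFn]
  rfl

theorem isNonIdentity_iff {n : ℕ} {μ : n.Partition} : IsNonIdentity μ ↔ colength μ ≠ 0 := by
  rw [IsNonIdentity, not_iff_not, colength]
  constructor
  · intro h
    rw [h, Multiset.card_replicate, Nat.sub_self]
  · intro h
    have hle : μ.parts.card ≤ μ.parts.sum := by
      simpa using Multiset.card_nsmul_le_sum (s := μ.parts) (a := 1) fun x hx => μ.parts_pos hx
    rw [μ.parts_sum] at hle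
    have hcard : μ.parts.card = n := by omega
    refine Multiset.eq_replicate.2 ⟨hcard, fun b hb => ?_⟩
    by_contra hne
    have hb1 := μ.parts_pos hb
    obtain ⟨s, hs⟩ := Multiset.exists_cons_of_mem hb
    have h1 : s.card ≤ s.sum := by
      simpa using Multiset.card_nsmul_le_sum (s := s) (a := 1)
        fun x hx => μ.parts_pos (by rw [hs]; exact Multiset.mem_cons_of_mem hx)
    have h2 := μ.parts_sum
    rw [hs, Multiset.sum_cons] at h2
    rw [hs, Multiset.card_cons] at hcard
    omega

theorem mem_families_iff {n k d : ℕ} {μ : Fin k → n.Partition} :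
    μ ∈ families n k d ↔ (∀ u, IsNonIdentity (μ u)) ∧ (Antitone fun u => colength (μ u)) ∧
      ∑ u, colength (μ u) = d := by
  simp only [families, Finset.mem_filter, Finset.mem_univ, true_and]

/-- The symmetrized weighted sum over the families of total colength `d` is the image of the
corresponding polynomial in the elementary symmetric functions. -/
theorem substJM_compSum {n k d : ℕ} (r : ℕ → ℕ → ℂ) :
    substJM n (compSum r (MvPolynomial.esymm (Fin n) ℂ) k d) =
      ∑ μ ∈ families n k d, ((autOrder μ : ℂ)⁻¹ * ∑ σ : Perm (Fin k),
        recWeight r k fun u => colength (μ (σ u))) • (List.ofFn fun u => cycleSum (μ u)).prod := by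
  classical
  have he : (fun a => substJM n (MvPolynomial.esymm (Fin n) ℂ a)) = fun a =>
      (Subalgebra.center ℂ (GroupAlg n)).val (∑ μ : n.Partition with colength μ = a,
        cycleSumCenter μ) := by
    funext a
    rw [substJM_esymm, map_sum]
    rfl
  rw [map_compSum, he, ← map_compSum]
  refine (congrArg _ (compSum_eq_sum_families r cycleSumCenter colength k d)).trans ?_
  rw [← sum_antitone_symmetrize (fun μ : Fin k → n.Partition =>
      (∀ u, colength (μ u) ≠ 0) ∧ ∑ u, colength (μ u) = d), map_sum]
  · have hfam : families n k d = Finset.univ.filter fun μ : Fin k → n.Partition =>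
        ((∀ u, colength (μ u) ≠ 0) ∧ ∑ u, colength (μ u) = d) ∧
          Antitone fun u => colength (μ u) := by
      ext μ
      simp only [mem_families_iff, Finset.mem_filter, Finset.mem_univ, true_and,
        isNonIdentity_iff]
      tauto
    rw [hfam]
    refine Finset.sum_congr rfl fun μ _ => ?_
    have hprod : ∀ σ : Perm (Fin k), ∏ u, cycleSumCenter ((μ ∘ σ) u) =
        ∏ u, cycleSumCenter (μ u) := fun σ => Equiv.prod_comp σ fun u => cycleSumCenter (μ u)
    simp_rw [hprod]
    rw [← Finset.sum_smul, smul_smul, map_smul, prod_ofFn_cycleSum]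
    rfl
  · intro μ σ
    refine and_congr ?_ ?_
    · exact ⟨fun h u => by simpa using h (σ⁻¹ u), fun h u => h (σ u)⟩
    · rw [show ∑ u, colength ((μ ∘ σ) u) = ∑ u, colength (μ u) from
        Equiv.sum_comp σ fun u => colength (μ u)]

theorem WErat_eq {n k : ℕ} (q : ℂ) (μ : Fin k → n.Partition) :
    WErat q μ = (autOrder μ : ℂ)⁻¹ * ∑ σ : Perm (Fin k),
      recWeight (ratioE q) k fun u => colength (μ (σ u)) := by
  simp [WErat, recWeight_ratioE, compWeight, weightDenom]

theorem WHrat_eq {n k : ℕ} (q : ℂ) (ν : Fin k → n.Partition) (hν : ∀ u, IsNonIdentity (ν u)) :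
    WHrat q ν = (autOrder ν : ℂ)⁻¹ * ∑ σ : Perm (Fin k),
      recWeight (ratioH q) k fun u => colength (ν (σ u)) := by
  have h : ∀ σ : Perm (Fin k), recWeight (ratioH q) k (fun u => colength (ν (σ u))) =
      signH ν * (1 / weightDenom q ν σ) := by
    intro σ
    rw [recWeight_ratioH q k _ fun u => isNonIdentity_iff.1 (hν _), signH,
      Equiv.sum_comp σ fun u => colength (ν u)]
    simp [compWeight, weightDenom]
  simp_rw [h]
  rw [← Finset.mul_sum, WHrat]
  ring

theorem substJM_compTotal_mul {n j e : ℕ} (q : ℂ) :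
    substJM n (compTotal (ratioE q) (MvPolynomial.esymm (Fin n) ℂ) e *
      compTotal (ratioH q) (MvPolynomial.esymm (Fin n) ℂ) (j - e)) =
      cycleCoeff n j e (Wqrat q) := by
  rw [map_mul, compTotal, compTotal, map_sum, map_sum, Finset.sum_mul_sum, cycleCoeff]
  refine Finset.sum_congr rfl fun k _ => Finset.sum_congr rfl fun k' _ => ?_
  rw [substJM_compSum, substJM_compSum, Finset.sum_mul_sum]
  refine Finset.sum_congr rfl fun μ _ => Finset.sum_congr rfl fun ν hν => ?_
  have hν' : ∀ v, IsNonIdentity (ν v) := (mem_families_iff.1 hν).1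
  rw [Wqrat, WErat_eq, WHrat_eq q ν hν', cycleSumProd, smul_mul_smul_comm]

/-- The expansion of `g_j(𝒥, q, t)` with the weights in rational form. -/
theorem gJM_eq_rat {n j : ℕ} {q : ℂ} (t : ℂ) (hq : ∀ m : ℕ, 1 ≤ m → m ≤ j → q ^ m ≠ 1) :
    gJM n j q t = ∑ e ∈ Finset.range (j + 1), (-t) ^ e • cycleCoeff n j e (Wqrat q) := by
  rw [gJM, gPoly_eq_sum_compTotal n j q t hq, map_sum]
  refine Finset.sum_congr rfl fun e _ => ?_
  rw [map_smul, substJM_compTotal_mul]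

theorem prod_ofFn_cycleSum_mem_center {n k : ℕ} (μ : Fin k → n.Partition) :
    (List.ofFn fun u => cycleSum (μ u)).prod ∈ Subalgebra.center ℂ (GroupAlg n) := by
  rw [prod_ofFn_cycleSum]
  exact SetLike.coe_mem _

theorem cycleSumProd_mem_center {n k k' : ℕ} (μ : Fin k → n.Partition)
    (ν : Fin k' → n.Partition) : cycleSumProd μ ν ∈ Subalgebra.center ℂ (GroupAlg n) :=
  mul_mem (prod_ofFn_cycleSum_mem_center μ) (prod_ofFn_cycleSum_mem_center ν)

theorem cycleCoeff_mem_center (n j e : ℕ)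
    (W : (k k' : ℕ) → (Fin k → n.Partition) → (Fin k' → n.Partition) → ℂ) :
    cycleCoeff n j e W ∈ Subalgebra.center ℂ (GroupAlg n) :=
  sum_mem fun _ _ => sum_mem fun _ _ => sum_mem fun μ _ => sum_mem fun ν _ =>
    Subalgebra.smul_mem _ (cycleSumProd_mem_center μ ν) _

/-! ### The weights as convergent series -/

/-- Sequences with gaps at least `δ`: the weakly increasing ones for `δ = 0` and the strictly
increasing ones for `δ = 1`. -/
def HasGaps (δ : ℕ) {k : ℕ} (i : Fin k → ℕ) : Prop := ∀ u v, u < v → i u + δ ≤ i v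

theorem hasGaps_zero_iff {k : ℕ} {i : Fin k → ℕ} : HasGaps 0 i ↔ Monotone i :=
  ⟨fun h u v huv => huv.eq_or_lt.elim (fun h' => by rw [h']) fun h' => h u v h',
    fun h _ _ huv => h huv.le⟩

theorem hasGaps_one_iff {k : ℕ} {i : Fin k → ℕ} : HasGaps 1 i ↔ StrictMono i :=
  ⟨fun h u v huv => h u v huv, fun h _ _ huv => h huv⟩

/-- A sequence with gaps `≥ δ` is given by its first entry and the excesses of the other entries
over the first one plus `δ`. -/
def gapsConsEquiv (δ k : ℕ) :
    {i : Fin (k + 1) → ℕ // HasGaps δ i} ≃ ℕ × {i : Fin k → ℕ // HasGaps δ i} where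
  toFun i := (i.1 0, ⟨fun u => i.1 u.succ - (i.1 0 + δ), fun u v huv => by
    have h1 := i.2 u.succ v.succ (Fin.succ_lt_succ_iff.2 huv)
    have h2 := i.2 0 u.succ (Fin.succ_pos u)
    simp only
    omega⟩)
  invFun p := ⟨Fin.cons p.1 fun u => p.2.1 u + (p.1 + δ), by
    intro u v huv
    induction v using Fin.cases with
    | zero => exact absurd huv (Fin.not_lt_zero u)
    | succ v =>
      induction u using Fin.cases with
      | zero =>
        simp only [Fin.cons_zero, Fin.cons_succ]
        omega
      | succ u =>
        have h := p.2.2 u v (Fin.succ_lt_succ_iff.1 huv)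
        simp only [Fin.cons_succ]
        omega⟩
  left_inv i := by
    ext u
    induction u using Fin.cases with
    | zero => rfl
    | succ u =>
      have h2 := i.2 0 u.succ (Fin.succ_pos u)
      simp only [Fin.cons_succ]
      omega
  right_inv p := by
    refine Prod.ext rfl (Subtype.ext (funext fun u => ?_))
    simp

theorem hasSum_mul_complex {ι κ : Type*} {f : ι → ℂ} {g : κ → ℂ} {a b : ℂ} (hf : HasSum f a)
    (hg : HasSum g b) : HasSum (fun x : ι × κ => f x.1 * g x.2) (a * b) := by
  have hf' : Summable fun x => ‖f x‖ := hf.summable.norm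
  have hg' : Summable fun x => ‖g x‖ := hg.summable.norm
  exact HasSum.mul hf hg (summable_mul_of_summable_norm hf' hg')

/-- The sum over the first entry is geometric with ratio `q^{c_1 + ⋯ + c_k}`, so tail sums of `c`
appear here where `compWeight` has initial sums: hence the reversal. -/
theorem hasSum_hasGaps (δ : ℕ) {q : ℂ} (hq : ‖q‖ < 1) (k : ℕ) :
    ∀ c : Fin k → ℕ, (∀ u, c u ≠ 0) →
      HasSum (fun i : {i : Fin k → ℕ // HasGaps δ i} => ∏ u, q ^ (i.1 u * c u))
        (compWeight δ q fun u => c u.rev) := by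
  induction k with
  | zero =>
    intro c _
    have : Unique {i : Fin 0 → ℕ // HasGaps δ i} :=
      ⟨⟨⟨Fin.elim0, fun u => u.elim0⟩⟩, fun i => Subsingleton.elim _ _⟩
    simp [compWeight]
  | succ k ih =>
    intro c hc
    have h1 := ih (fun u => c u.succ) fun u => hc _
    have hne : ∑ u, c u ≠ 0 := by
      rw [Fin.sum_univ_succ]
      have := hc 0
      omega
    have hnorm : ‖q ^ ∑ u, c u‖ < 1 := by
      rw [norm_pow]
      exact pow_lt_one₀ (norm_nonneg q) hq hne
    have h2 := hasSum_geometric_of_norm_lt_one hnorm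
    have h4 := (hasSum_mul_complex h2 h1).mul_left (q ^ (δ * ∑ u : Fin k, c u.succ))
    have hval : compWeight δ q (fun u => c u.rev) = q ^ (δ * ∑ u : Fin k, c u.succ) *
        ((1 - q ^ ∑ u, c u)⁻¹ * compWeight δ q fun u : Fin k => c u.rev.succ) := by
      rw [compWeight_succ]
      simp only [Fin.rev_castSucc]
      rw [show ∑ u : Fin k, c u.rev.succ = ∑ u : Fin k, c u.succ from
          Equiv.sum_comp Fin.revPerm fun u : Fin k => c u.succ,
        show ∑ u : Fin (k + 1), c u.rev = ∑ u, c u from Equiv.sum_comp Fin.revPerm c,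
        div_eq_mul_inv, mul_assoc]
    rw [hval, ← (gapsConsEquiv δ k).symm.hasSum_iff]
    have hfun : (fun i : {i : Fin (k + 1) → ℕ // HasGaps δ i} => ∏ u, q ^ (i.1 u * c u)) ∘
        (gapsConsEquiv δ k).symm = fun p => q ^ (δ * ∑ u : Fin k, c u.succ) *
          ((q ^ ∑ u, c u) ^ p.1 * ∏ u : Fin k, q ^ (p.2.1 u * c u.succ)) := by
      funext p
      simp only [Function.comp_apply, gapsConsEquiv, Equiv.coe_fn_symm_mk,
        Fin.cons_zero, Fin.cons_succ, Finset.prod_pow_eq_pow_sum, ← pow_mul, ← pow_add, add_mul,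
        Finset.sum_add_distrib, ← Finset.mul_sum, Fin.sum_univ_succ]
      congr 1
      ring
    rw [hfun]
    exact h4

/-- Summation over all permutations absorbs the reversal of the order of the parts. -/
theorem sum_perm_comp_rev {k : ℕ} {M : Type*} [AddCommMonoid M] (f : (Fin k → Fin k) → M) :
    ∑ σ : Perm (Fin k), f (fun u => σ u.rev) = ∑ σ : Perm (Fin k), f σ := by
  refine Fintype.sum_equiv (Equiv.mulRight Fin.revPerm) _ _ fun σ => ?_
  rfl

theorem hasSum_strictMono {n k : ℕ} {q : ℂ} (hq : ‖q‖ < 1) {μ : Fin k → n.Partition}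
    (hμ : ∀ u, IsNonIdentity (μ u)) (σ : Perm (Fin k)) :
    HasSum (fun i : {i : Fin k → ℕ // StrictMono i} => weightTerm q μ σ i.1)
      (compWeight 1 q fun u => colength (μ (σ u.rev))) := by
  have h := hasSum_hasGaps 1 hq k (fun u => colength (μ (σ u)))
    fun u => isNonIdentity_iff.1 (hμ _)
  let e : {i : Fin k → ℕ // HasGaps 1 i} ≃ {i : Fin k → ℕ // StrictMono i} :=
    Equiv.subtypeEquivRight fun _ => hasGaps_one_iff
  have he : (fun i : {i : Fin k → ℕ // StrictMono i} => weightTerm q μ σ i.1) ∘ e =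
      fun i => ∏ u, q ^ (i.1 u * colength (μ (σ u))) := funext fun i => rfl
  rw [← e.hasSum_iff, he]
  exact h

theorem hasSum_monotone {n k : ℕ} {q : ℂ} (hq : ‖q‖ < 1) {μ : Fin k → n.Partition}
    (hμ : ∀ u, IsNonIdentity (μ u)) (σ : Perm (Fin k)) :
    HasSum (fun i : {i : Fin k → ℕ // Monotone i} => weightTerm q μ σ i.1)
      (compWeight 0 q fun u => colength (μ (σ u.rev))) := by
  have h := hasSum_hasGaps 0 hq k (fun u => colength (μ (σ u)))
    fun u => isNonIdentity_iff.1 (hμ _)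
  let e : {i : Fin k → ℕ // HasGaps 0 i} ≃ {i : Fin k → ℕ // Monotone i} :=
    Equiv.subtypeEquivRight fun _ => hasGaps_zero_iff
  have he : (fun i : {i : Fin k → ℕ // Monotone i} => weightTerm q μ σ i.1) ∘ e =
      fun i => ∏ u, q ^ (i.1 u * colength (μ (σ u))) := funext fun i => rfl
  rw [← e.hasSum_iff, he]
  exact h

theorem WE_eq_WErat {n k : ℕ} {q : ℂ} (hq : ‖q‖ < 1) {μ : Fin k → n.Partition}
    (hμ : ∀ u, IsNonIdentity (μ u)) : WE q μ = WErat q μ := by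
  rw [WE, WErat_eq]
  simp_rw [(hasSum_strictMono hq hμ _).tsum_eq, recWeight_ratioE]
  rw [sum_perm_comp_rev fun τ => compWeight 1 q fun u => colength (μ (τ u))]

theorem WH_eq_WHrat {n k : ℕ} {q : ℂ} (hq : ‖q‖ < 1) {μ : Fin k → n.Partition}
    (hμ : ∀ u, IsNonIdentity (μ u)) : WH q μ = WHrat q μ := by
  rw [WH, WHrat]
  simp_rw [(hasSum_monotone hq hμ _).tsum_eq]
  rw [sum_perm_comp_rev fun τ => compWeight 0 q fun u => colength (μ (τ u))]
  simp [compWeight, weightDenom]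

theorem cycleCoeff_Wq_eq {n j e : ℕ} {q : ℂ} (hq : ‖q‖ < 1) :
    cycleCoeff n j e (Wq q) = cycleCoeff n j e (Wqrat q) := by
  refine Finset.sum_congr rfl fun k _ => Finset.sum_congr rfl fun k' _ =>
    Finset.sum_congr rfl fun μ hμ => Finset.sum_congr rfl fun ν hν => ?_
  rw [Wq, Wqrat, WE_eq_WErat hq (mem_families_iff.1 hμ).1,
    WH_eq_WHrat hq (mem_families_iff.1 hν).1]

/-! ### Hurwitz numbers as coefficients of products of cycle-type sums -/

theorem finite_forall₂_cyc {n : ℕ} (L : List n.Partition) (g : Perm (Fin n)) :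
    Finite {w : List (Perm (Fin n)) //
      List.Forall₂ (fun h μ => h ∈ cyc μ) w L ∧ w.prod = g} :=
  ((List.finite_length_eq (Perm (Fin n)) L.length).subset
    fun _ hw => hw.1.length_eq).to_subtype

theorem coeff_cycleSum {n : ℕ} (μ : n.Partition) (g : Perm (Fin n)) :
    (cycleSum μ).coeff g = if g ∈ cyc μ then 1 else 0 := by
  classical
  simp [cycleSum, MonoidAlgebra.coeff_sum, Finsupp.finsetSum_apply, Finsupp.single_apply]

/-- The coefficients of a product of cycle-type sums count factorizations. -/
theorem coeff_prod_cycleSum {n : ℕ} (L : List n.Partition) : ∀ g : Perm (Fin n),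
    (L.map cycleSum).prod.coeff g = (Nat.card {w : List (Perm (Fin n)) //
      List.Forall₂ (fun h μ => h ∈ cyc μ) w L ∧ w.prod = g} : ℂ) := by
  induction L with
  | nil =>
    intro g
    rw [List.map_nil, List.prod_nil, MonoidAlgebra.one_def, MonoidAlgebra.coeff_single,
      Finsupp.single_apply]
    simp only [List.forall₂_nil_right_iff]
    split_ifs with h
    · have : Unique {w : List (Perm (Fin n)) // w = [] ∧ w.prod = g} :=
        ⟨⟨⟨[], rfl, h⟩⟩, fun w => Subtype.ext w.2.1⟩
      rw [Nat.card_unique, Nat.cast_one]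
    · have : IsEmpty {w : List (Perm (Fin n)) // w = [] ∧ w.prod = g} :=
        ⟨fun w => h (by have := w.2.2; rw [w.2.1] at this; simpa using this)⟩
      rw [Nat.card_of_isEmpty, Nat.cast_zero]
  | cons μ L ih =>
    intro g
    have e : {w : List (Perm (Fin n)) //
        List.Forall₂ (fun h μ => h ∈ cyc μ) w (μ :: L) ∧ w.prod = g} ≃
        Σ h : cyc μ, {w : List (Perm (Fin n)) //
          List.Forall₂ (fun h μ => h ∈ cyc μ) w L ∧ w.prod = (h : Perm (Fin n))⁻¹ * g} :=
      { toFun := fun w => match w with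
          | ⟨[], hw⟩ => absurd hw.1 (by simp)
          | ⟨h :: w, hw⟩ => ⟨⟨h, (List.forall₂_cons.1 hw.1).1⟩, w, (List.forall₂_cons.1 hw.1).2, by
              rw [eq_inv_mul_iff_mul_eq, ← List.prod_cons]
              exact hw.2⟩
        invFun := fun p => ⟨p.1.1 :: p.2.1, List.forall₂_cons.2 ⟨p.1.2, p.2.2.1⟩, by
          rw [List.prod_cons, p.2.2.2, mul_inv_cancel_left]⟩
        left_inv := by
          rintro ⟨_ | ⟨h, w⟩, hw⟩
          · exact absurd hw.1 (by simp)
          · rfl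
        right_inv := fun p => rfl }
    have hfin := fun h : cyc μ => finite_forall₂_cyc L ((h : Perm (Fin n))⁻¹ * g)
    rw [Nat.card_congr e, Nat.card_sigma, List.map_cons, List.prod_cons, cycleSum, Finset.sum_mul,
      MonoidAlgebra.coeff_sum, Finsupp.finsetSum_apply, Nat.cast_sum,
      ← Finset.sum_coe_sort]
    refine Finset.sum_congr rfl fun h _ => ?_
    rw [MonoidAlgebra.coeff_single_mul_apply, one_mul, ih]

theorem hurwitz_eq_coeff {n : ℕ} (L : List n.Partition) :
    hurwitz L = (L.map cycleSum).prod.coeff 1 / n.factorial := by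
  rw [hurwitz, coeff_prod_cycleSum]

theorem coeff_eq_of_isConj {n : ℕ} {A : GroupAlg n}
    (hA : A ∈ Subalgebra.center ℂ (GroupAlg n)) {g h : Perm (Fin n)} (hc : IsConj g h) :
    A.coeff g = A.coeff h := by
  obtain ⟨x, rfl⟩ := isConj_iff.1 hc
  have h1 := Subalgebra.mem_center_iff.1 hA (MonoidAlgebra.single x 1)
  have h2 := congrArg (fun B : GroupAlg n => B.coeff (x * g)) h1
  simpa [MonoidAlgebra.coeff_single_mul_apply, MonoidAlgebra.coeff_mul_single_apply] using h2

/-- `|cyc(ρ)| z_ρ = n!`, for the cycle type `ρ` of a permutation. -/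
theorem card_cyc_mul_zPart {n : ℕ} (g : Perm (Fin n)) :
    (cyc (cycleTypePartition g)).card * zPart (cycleTypePartition g) = n.factorial := by
  have hcyc : cyc (cycleTypePartition g) =
      Finset.univ.filter fun h : Perm (Fin n) => h.cycleType = g.cycleType := by
    ext h
    rw [cyc, Finset.mem_filter, Finset.mem_filter, ← Perm.isConj_iff_cycleType_eq,
      Perm.partition_eq_of_isConj,
      Nat.Partition.ext_iff]
    rfl
  have hparts : (cycleTypePartition g).parts =
      g.cycleType + Multiset.replicate (n - g.cycleType.sum) 1 := by
    rw [Perm.sum_cycleType]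
    change g.partition.parts = _
    rw [Perm.parts_partition, Fintype.card_fin]
  have h1 : 1 ∉ g.cycleType := fun h => absurd (Perm.two_le_of_mem_cycleType h) (by norm_num)
  have hz : zPart (cycleTypePartition g) = (n - g.cycleType.sum).factorial * g.cycleType.prod *
      ∏ i ∈ g.cycleType.toFinset, (g.cycleType.count i).factorial := by
    have hsub : (cycleTypePartition g).parts.toFinset ⊆ insert 1 g.cycleType.toFinset := by
      intro i hi
      rw [Multiset.mem_toFinset, hparts, Multiset.mem_add] at hi
      rw [Finset.mem_insert, Multiset.mem_toFinset]
      exact hi.symm.imp Multiset.eq_of_mem_replicate id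
    rw [zPart_eq_prod_of_subset _ hsub, Finset.prod_insert (by simpa using h1), hparts,
      Finset.prod_multiset_count g.cycleType, mul_assoc (Nat.factorial _), ← Finset.prod_mul_distrib]
    congr 1
    · simp [Multiset.count_eq_zero_of_notMem h1]
    · refine Finset.prod_congr rfl fun i hi => ?_
      have hi1 : i ≠ 1 := by
        rintro rfl
        exact h1 (Multiset.mem_toFinset.1 hi)
      rw [Multiset.count_add, Multiset.count_replicate, if_neg hi1.symm, add_zero]
  have h := Perm.card_of_cycleType_mul_eq (Fin n) g.cycleType
  rw [if_pos ⟨by rw [Perm.sum_cycleType]; exact Finset.card_le_univ _,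
    fun a ha => Perm.two_le_of_mem_cycleType ha⟩, Fintype.card_fin] at h
  rw [hcyc, hz]
  exact h

theorem isConj_of_mem_cyc {n : ℕ} {ρ : n.Partition} {g h : Perm (Fin n)} (hg : g ∈ cyc ρ)
    (hh : h ∈ cyc ρ) : IsConj g h := by
  simp only [cyc, Finset.mem_filter, Finset.mem_univ, true_and] at hg hh
  rw [Perm.partition_eq_of_isConj, Nat.Partition.ext_iff, hg, hh]

/-- A central element is constant on each `cyc(ρ)`, and its value there is read off from the
coefficient of the identity in its product with `C_ρ`. -/
theorem prod_cycleSum_eq_sum_hurwitz {n : ℕ} (L : List n.Partition)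
    (hL : (L.map cycleSum).prod ∈ Subalgebra.center ℂ (GroupAlg n)) :
    (L.map cycleSum).prod =
      ∑ ρ : n.Partition, (hurwitz (L ++ [ρ]) * (zPart ρ : ℂ)) • cycleSum ρ := by
  refine MonoidAlgebra.ext (Finsupp.ext fun g => ?_)
  rw [MonoidAlgebra.coeff_sum, Finsupp.finsetSum_apply,
    Finset.sum_eq_single (cycleTypePartition g)]
  · have hg : g ∈ cyc (cycleTypePartition g) := mem_cyc_iff.2 rfl
    rw [MonoidAlgebra.coeff_smul, Finsupp.smul_apply, coeff_cycleSum, if_pos hg, smul_eq_mul,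
      mul_one, hurwitz_eq_coeff, List.map_append, List.prod_append, List.map_singleton,
      List.prod_singleton]
    set A := (L.map cycleSum).prod
    have h1 : (A * cycleSum (cycleTypePartition g)).coeff 1 =
        (cyc (cycleTypePartition g)).card * A.coeff g := by
      rw [cycleSum, Finset.mul_sum, MonoidAlgebra.coeff_sum, Finsupp.finsetSum_apply,
        ← nsmul_eq_mul, ← Finset.sum_const]
      refine Finset.sum_congr rfl fun h hh => ?_
      rw [MonoidAlgebra.coeff_mul_single_apply, mul_one, one_mul]
      refine coeff_eq_of_isConj hL ?_
      have h2 : IsConj h⁻¹ h := by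
        rw [Perm.isConj_iff_cycleType_eq, Perm.cycleType_inv]
      exact h2.trans (isConj_of_mem_cyc hh hg)
    have h3 : (n.factorial : ℂ) ≠ 0 := Nat.cast_ne_zero.2 n.factorial_ne_zero
    have h4 : ((cyc (cycleTypePartition g)).card : ℂ) * zPart (cycleTypePartition g) =
        n.factorial := by
      exact_mod_cast card_cyc_mul_zPart g
    rw [h1, div_mul_eq_mul_div, eq_div_iff h3, ← h4]
    ring
  · intro ρ _ hρ
    rw [MonoidAlgebra.coeff_smul, Finsupp.smul_apply, coeff_cycleSum, if_neg, smul_zero]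
    exact fun h => hρ (mem_cyc_iff.1 h).symm
  · simp

theorem cycleSumProd_eq_sum_hurwitz {n k k' : ℕ} (μ : Fin k → n.Partition)
    (ν : Fin k' → n.Partition) :
    cycleSumProd μ ν = ∑ ρ : n.Partition,
      (hurwitz (List.ofFn μ ++ List.ofFn ν ++ [ρ]) * (zPart ρ : ℂ)) • cycleSum ρ := by
  have h : cycleSumProd μ ν = ((List.ofFn μ ++ List.ofFn ν).map cycleSum).prod := by
    rw [cycleSumProd, List.map_append, List.prod_append, List.map_ofFn, List.map_ofFn]
    rfl
  rw [h]
  exact prod_cycleSum_eq_sum_hurwitz _ (h ▸ cycleSumProd_mem_center μ ν)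

end QuantumHurwitz

theorem mainTheorem2 (n j : ℕ) (q t : ℂ) (hq : ∀ m : ℕ, 1 ≤ m → m ≤ j → q ^ m ≠ 1) :
    QuantumHurwitz.gJM n j q t ∈ Subalgebra.center ℂ (QuantumHurwitz.GroupAlg n) ∧
    QuantumHurwitz.gJM n j q t =
      ∑ e ∈ Finset.range (j + 1),
        (-t) ^ e • QuantumHurwitz.cycleCoeff n j e (QuantumHurwitz.Wqrat q) ∧
    (‖q‖ < 1 →
      QuantumHurwitz.gJM n j q t =
        ∑ e ∈ Finset.range (j + 1),
          (-t) ^ e • QuantumHurwitz.cycleCoeff n j e (QuantumHurwitz.Wq q)) ∧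
    (‖q‖ < 1 → ∀ (k : ℕ) (μ : Fin k → n.Partition),
      (∀ u, QuantumHurwitz.IsNonIdentity (μ u)) →
        (∀ σ : Equiv.Perm (Fin k),
          Summable (fun i : {i : Fin k → ℕ // StrictMono i} =>
            QuantumHurwitz.weightTerm q μ σ i.1) ∧
          Summable (fun i : {i : Fin k → ℕ // Monotone i} =>
            QuantumHurwitz.weightTerm q μ σ i.1)) ∧
        QuantumHurwitz.WE q μ = QuantumHurwitz.WErat q μ ∧
        QuantumHurwitz.WH q μ = QuantumHurwitz.WHrat q μ) ∧
    (∀ (k k' : ℕ) (μ : Fin k → n.Partition) (ν : Fin k' → n.Partition),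
      QuantumHurwitz.cycleSumProd μ ν =
        ∑ ρ : n.Partition,
          (QuantumHurwitz.hurwitz (List.ofFn μ ++ List.ofFn ν ++ [ρ]) *
            (QuantumHurwitz.zPart ρ : ℂ)) • QuantumHurwitz.cycleSum ρ) := by
  refine ⟨?_, QuantumHurwitz.gJM_eq_rat t hq, fun hn => ?_, fun hn k μ hμ => ⟨fun σ =>
    ⟨(QuantumHurwitz.hasSum_strictMono hn hμ σ).summable,
      (QuantumHurwitz.hasSum_monotone hn hμ σ).summable⟩,
    QuantumHurwitz.WE_eq_WErat hn hμ, QuantumHurwitz.WH_eq_WHrat hn hμ⟩,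
    fun k k' μ ν => QuantumHurwitz.cycleSumProd_eq_sum_hurwitz μ ν⟩
  · rw [QuantumHurwitz.gJM_eq_rat t hq]
    exact sum_mem fun e _ => Subalgebra.smul_mem _ (QuantumHurwitz.cycleCoeff_mem_center n j e _) _
  · rw [QuantumHurwitz.gJM_eq_rat t hq]
    simp_rw [QuantumHurwitz.cycleCoeff_Wq_eq hn]
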